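/- **Setting.** A linear pentapod consists of five platform anchor points $\mathsf m_i$ on an oriented line $\mathsf p$ of the moving space, with arc-length coordinates $t_i$, five base anchor points $\mathsf M_i$ in the fixed Euclidean space $\mathbb R^3$, and five leg lengths $R_i$; the five pairs $(\mathsf m_i,\mathsf M_i)$ are pairwise distinct. Let $a_4,a_r,a_c\in\mathbb R$ with $a_c\ne 0$. *Type 1.* There is a map $\sigma(t)=(w(t):y_1(t):y_2(t):y_3(t))$ from $\mathsf p$ to projective 3-space, given by four linearly independent real polynomials of degree at most $3$ (so its image $\mathsf P$ is an irreducible space cubic), such that $\mathsf P$ meets the ideal plane in the real point $\mathsf W=\sigma(a_4)$ and in $\sigma(a_r\pm i a_c)$, where the latter are the cyclic points of the planes orthogonal to $\mathsf W$; the ideal point of $\mathsf p$ is mapped to a finite point $\mathsf M_5^*$; and each $\mathsf M_i=\sigma(t_i)$ is finite. *Type 2.* There is a map $\sigma(t)=(w(t):y_1(t):y_2(t):y_3(t))$ of degree $2$ from $\mathsf p$ onto a circle $\mathsf q$, mapping $a_r\pm ia_c$ to the cyclic points of the plane of $\mathsf q$ and the ideal point of $\mathsf p$ to the finite point $\mathsf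 M_5^*$. Let $\mathsf s$ be the line through $\sigma(a_4)$ orthogonal to the plane of $\mathsf q$. For each $i$, $\mathsf M_i=\sigma(t_i)$ if $t_i\ne a_4$, and $\mathsf M_i\in \mathsf s$ if $t_i=a_4$. Moreover the pentapod is not architecturally singular, i.e. not in every pose of $\mathsf p$ are the Plücker coordinates of the carrier lines of the five legs linearly dependent. A self-motion is a continuous one-parameter family of Euclidean displacements over an open interval which keeps all leg lengths $|\mathsf m_i\mathsf M_i|=R_i$ and moves some point of $\mathsf p$ (so it is not merely a rotation about $\mathsf p$). Displacements are given by Study parameters $(e_0:\dots:e_3:f_0:\dots:f_3)$ with $\sum e_if_i=0$ and $e_0^2+\dots+e_3^2\neq0$. If $e_0=f_0=0$, the displacement is the reflection in the line with Plücker coordinates $(e_1:e_2:e_3:f_1:f_2:f_3)$. A one-parameter family of such reflections is a line-symmetric motion, and the reflection lines are the generators of its basic surface. **Theorem.** Consider a self-motion of a linear pentapod of Type 1 or Type 2. There is a real number $p_5$ such that, during the self-motion, the plane orthogonal to $\mathsf p$ through the point of $\mathsf p$ with coordinate $p_5$ always contains $\mathsf M_5^*$. Let $\mathcal D$ be the set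 of all placements $t\mapsto \mathbf b+t\,\mathbf d$ ($\mathbf b,\mathbf d\in\mathbb R^3$, $\|\mathbf d\|=1$) of $\mathsf p$ in a new moving frame with respect to which the given motion of $\mathsf p$ is generated by a line-symmetric motion: at every instant there are Study parameters with $e_0=f_0=0$, whose displacement takes $\mathbf b+t\,\mathbf d$, for every $t$, to the position of the point of $\mathsf p$ with coordinate $t$ under the self-motion. Here the line-symmetric motion is required to be continuous at least at all instants at which the direction of $\mathsf p$ differs from $-\mathbf d$, and to be real-analytic at all instants if the points of $\mathsf p$ move real-analytically. Then $\mathcal D$ has Hausdorff dimension $1$, unless $p_5=a_4=a_r$; and in the special case $p_5=a_4=a_r$ it has Hausdorff dimension $2$. In particular the self-motion is generated by a one-dimensional, respectively two-dimensional, set of line-symmetric motions. -/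

import Mathlib

open Polynomial
open scoped Matrix

noncomputable section

/-- Euclidean three-space (coordinates with respect to an orthonormal frame). -/
abbrev E3 : Type := EuclideanSpace ℝ (Fin 3)

/-! Study parameters `(e₀ : … : e₃ : f₀ : … : f₃)` of Euclidean displacements. -/

/-- `N = e₀² + e₁² + e₂² + e₃²`. -/
def studyN (e : Fin 4 → ℝ) : ℝ := e 0 ^ 2 + e 1 ^ 2 + e 2 ^ 2 + e 3 ^ 2

/-- The point lies on the Study quadric and is not in the exceptional subspace `e = 0`. -/
def IsStudy (e f : Fin 4 → ℝ) : Prop :=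
  e 0 * f 0 + e 1 * f 1 + e 2 * f 2 + e 3 * f 3 = 0 ∧ studyN e ≠ 0

/-- The rotation matrix belonging to `e`, up to the factor `N`. -/
def studyRot (e : Fin 4 → ℝ) : Matrix (Fin 3) (Fin 3) ℝ :=
  !![e 0 ^ 2 + e 1 ^ 2 - e 2 ^ 2 - e 3 ^ 2, 2 * (e 1 * e 2 - e 0 * e 3), 2 * (e 1 * e 3 + e 0 * e 2);
     2 * (e 1 * e 2 + e 0 * e 3), e 0 ^ 2 - e 1 ^ 2 + e 2 ^ 2 - e 3 ^ 2, 2 * (e 2 * e 3 - e 0 * e 1);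
     2 * (e 1 * e 3 - e 0 * e 2), 2 * (e 2 * e 3 + e 0 * e 1), e 0 ^ 2 - e 1 ^ 2 - e 2 ^ 2 + e 3 ^ 2]

/-- The translation vector belonging to `(e, f)`, up to the factor `N`. -/
def studyTrans (e f : Fin 4 → ℝ) : Fin 3 → ℝ :=
  ![-2 * (e 0 * f 1 - e 1 * f 0 + e 2 * f 3 - e 3 * f 2),
    -2 * (e 0 * f 2 - e 2 * f 0 + e 3 * f 1 - e 1 * f 3),
    -2 * (e 0 * f 3 - e 3 * f 0 + e 1 * f 2 - e 2 * f 1)]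

/-- The displacement with Study parameters `(e, f)`: a point of the moving system is sent to its
position in the fixed system (the division by `N` makes the formula homogeneous). -/
def studyMap (e f : Fin 4 → ℝ) (m : E3) : E3 :=
  WithLp.toLp 2 ((studyN e)⁻¹ • (studyRot e *ᵥ m.ofLp + studyTrans e f))

/-- The vector `(e₁, e₂, e₃)`. -/
def vecPart (e : Fin 4 → ℝ) : E3 := !₂[e 1, e 2, e 3]

/-- Cross product in `E3`. -/
def cross (x y : E3) : E3 := WithLp.toLp 2 (x.ofLp ⨯₃ y.ofLp)

/-- Reflection in the line through `G` with direction `v ≠ 0`. -/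
def lineReflection (G v : E3) (m : E3) : E3 := G + (ℝ ∙ v).reflection (m - G)

/-- The displacement `(e, f)` has `e₀ = f₀ = 0` and is the reflection in the line with Plücker
coordinates `(e₁ : e₂ : e₃ : f₁ : f₂ : f₃)`, whose pedal point with respect to the origin
is `(f × e) / N`. -/
def IsLineReflection (e f : Fin 4 → ℝ) : Prop :=
  IsStudy e f ∧ e 0 = 0 ∧ f 0 = 0 ∧
    ∀ m, studyMap e f m =
      lineReflection ((studyN e)⁻¹ • cross (vecPart f) (vecPart e)) (vecPart e) m

/-- A linear pentapod with given leg lengths: five platform anchor points on the oriented line `p`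
(through `org` with unit direction `dir`) of the moving system, at the arc-length coordinates
`coord i`; five base anchor points `base i` of the fixed system; the leg lengths `len i`.
The five legs are pairwise distinct. -/
structure LinearPentapod where
  org : E3
  dir : E3
  norm_dir : ‖dir‖ = 1
  coord : Fin 5 → ℝ
  base : Fin 5 → E3
  len : Fin 5 → ℝ
  distinct : Function.Injective fun i => (coord i, base i)

namespace LinearPentapod

variable (L : LinearPentapod)

/-- The point of `p` with arc-length coordinate `t`. -/
def point (t : ℝ) : E3 := L.org + t • L.dir

/-- The pentapod is architecturally singular: in every pose of `p` (given by the image `x` of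
`point 0` and the image `u` of `dir`) the five carrier lines of the legs have linearly dependent
Plücker coordinates. -/
def IsArchitecturallySingular : Prop :=
  ∀ x u : E3, ‖u‖ = 1 → ¬ LinearIndependent ℝ fun i : Fin 5 =>
    ((L.base i - (x + L.coord i • u), cross (x + L.coord i • u) (L.base i)) : E3 × E3)

/-- The finite point with homogeneous coordinates `(w(t) : y₁(t) : y₂(t) : y₃(t))`. -/
def ratPoint (w : ℝ[X]) (y : Fin 3 → ℝ[X]) (t : ℝ) : E3 :=
  WithLp.toLp 2 fun j => (y j).eval t / w.eval t

/-- The value of a real polynomial at `a_r + i a_c`. -/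
def cval (q : ℝ[X]) (a_r a_c : ℝ) : ℂ := aeval ((a_r : ℂ) + a_c * Complex.I) q

/-- Type 1. The map `σ(t) = (w(t) : y₁(t) : y₂(t) : y₃(t))` from `p` to the cubic `P` of sphere
centers parametrizes an irreducible space cubic (four linearly independent polynomials of degree at
most 3). `P` is a straight cubic circle: it meets the ideal plane in the real point `W = σ(a₄)` and
in the conjugate complex points `σ(a_r ± i a_c)`, which are the cyclic points of the planes
orthogonal to `W`. The ideal point `U` of `p` is mapped to the finite point `M₅`. Each leg joins a
point of `p` to its image under `σ`. -/
def IsType1 (a₄ a_r a_c : ℝ) (M₅ : E3) : Prop :=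
  ∃ (w : ℝ[X]) (y : Fin 3 → ℝ[X]),
    w.natDegree ≤ 3 ∧ (∀ j, (y j).natDegree ≤ 3) ∧
    LinearIndependent ℝ ![w, y 0, y 1, y 2] ∧
    a_c ≠ 0 ∧ w.eval a₄ = 0 ∧ cval w a_r a_c = 0 ∧
    (∑ j, cval (y j) a_r a_c ^ 2 = 0) ∧
    (∑ j, cval (y j) a_r a_c * (((y j).eval a₄ : ℝ) : ℂ) = 0) ∧
    w.coeff 3 ≠ 0 ∧ (∀ j, M₅ j = (y j).coeff 3 / w.coeff 3) ∧
    ∀ i, w.eval (L.coord i) ≠ 0 ∧ L.base i = ratPoint w y (L.coord i)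

/-- Type 2. `P` splits into a circle `q` and a line `s`, which meets `q` in `Q` and is orthogonal to
the carrier plane of `q`. The circle is parametrized by the projective map
`σ(t) = (w(t) : y₁(t) : y₂(t) : y₃(t))` of degree 2 from `p`, where `a_r ± i a_c` are mapped to its
cyclic points; `Q = σ(a₄)`, and `s` has the direction `ν`. The ideal point `U` of `p` is mapped
to `M₅`. A point of `p` different from the point `S` (with coordinate `a₄`) is joined by a leg to its
image under `σ`; the point `S` may be joined to any point of `s`. The pentapod is not
architecturally singular. -/
def IsType2 (a₄ a_r a_c : ℝ) (M₅ : E3) : Prop :=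
  ∃ (w : ℝ[X]) (y : Fin 3 → ℝ[X]) (ν : E3),
    w.natDegree ≤ 2 ∧ (∀ j, (y j).natDegree ≤ 2) ∧
    a_c ≠ 0 ∧ cval w a_r a_c = 0 ∧
    (∃ j, cval (y j) a_r a_c ≠ 0) ∧
    (∑ j, cval (y j) a_r a_c ^ 2 = 0) ∧
    ν ≠ 0 ∧ (∑ j, cval (y j) a_r a_c * ((ν j : ℝ) : ℂ) = 0) ∧
    w.coeff 2 ≠ 0 ∧ (∀ j, M₅ j = (y j).coeff 2 / w.coeff 2) ∧
    (∀ i, (L.coord i ≠ a₄ ∧ L.base i = ratPoint w y (L.coord i)) ∨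
      (L.coord i = a₄ ∧ ∃ c : ℝ, L.base i = ratPoint w y a₄ + c • ν)) ∧
    ¬ L.IsArchitecturallySingular

/-- A self-motion over the open interval `I`: a continuous one-parameter family of displacements
under which the five leg lengths are kept and which moves some point of `p` (it is not just
a rotation about `p`). -/
structure IsSelfMotion (I : Set ℝ) (e f : ℝ → Fin 4 → ℝ) : Prop where
  isOpen : IsOpen I
  ordConnected : I.OrdConnected
  study : ∀ s ∈ I, IsStudy (e s) (f s)
  continuous : ∀ m, ContinuousOn (fun s => studyMap (e s) (f s) m) I
  legs : ∀ s ∈ I, ∀ i, dist (studyMap (e s) (f s) (L.point (L.coord i))) (L.base i) = L.len i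
  moves : ∃ t, ∃ s ∈ I, ∃ s' ∈ I,
    studyMap (e s) (f s) (L.point t) ≠ studyMap (e s') (f s') (L.point t)

/-- The direction of `p` in the fixed system under the displacement `(e, f)`. -/
def dirImage (e f : Fin 4 → ℝ) : E3 := studyMap e f (L.point 1) - studyMap e f (L.point 0)

/-- The placements of `p` with respect to a new moving frame (`t ↦ b + t d`, with a unit vector `d`)
for which the motion of `p` given by `(e, f)` over `I` is generated by a line-symmetric motion
`(e', f')`, that is, by the reflections in the generators of a basic surface.
Regularity: each trajectory of the line-symmetric motion is continuous, except possibly in poses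
where `p` has the direction `-d` (then the axis of the half-turn is not unique if only the
directions are given), and it is real-analytic on all of `I` if the points of `p` move
real-analytically. -/
def lineSymmetricPlacements (I : Set ℝ) (e f : ℝ → Fin 4 → ℝ) : Set (E3 × E3) :=
  {bd | ‖bd.2‖ = 1 ∧ ∃ e' f' : ℝ → Fin 4 → ℝ,
    (∀ s ∈ I, IsLineReflection (e' s) (f' s)) ∧
    (∀ s ∈ I, ∀ t : ℝ,
      studyMap (e' s) (f' s) (bd.1 + t • bd.2) = studyMap (e s) (f s) (L.point t)) ∧
    (∀ m, ContinuousOn (fun s => studyMap (e' s) (f' s) m)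
      {s ∈ I | L.dirImage (e s) (f s) ≠ -bd.2}) ∧
    ((∀ t, AnalyticOnNhd ℝ (fun s => studyMap (e s) (f s) (L.point t)) I) →
      ∀ m, AnalyticOnNhd ℝ (fun s => studyMap (e' s) (f' s) m) I)}

end LinearPentapod

end

/-!
Write a pose of `p` as `t ↦ M₅ + x + t u` with `‖u‖ = 1`. In both types the base points have the
partial fraction form `M₅ + (A + (t - a_r) B) / D + c V` with `D = (t - a_r)² + a_c²`, where
`V, A, B` are nonzero and pairwise orthogonal, `‖A‖ = |a_c| ‖B‖`, and `c (t - a₄)` is the constant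
`ε` (`1` in type 1, `0` in type 2); this is `HasNormalForm`. In the leg equation
the only unknown terms are `‖x‖²`, `t (x · u)` and `(x + t u) · (σ(t) - M₅)`, and polynomial division
of the last one by `D` and `t - a₄` makes the equation linear in the row
`(1, t, 1/D, (t - a_r)/D, c)`. The five rows are independent (distinct `t` in type 1, the absence of
an architectural singularity in type 2), hence five functions of the pose are constant during a
self-motion (`exists_constants`). Three of them say `x = C - T u` with a constant vector `C` and a
linear map `T` (`pencilMap`). The fourth is `x · u = -p₅`, which is the statement on the orthogonal
plane. The fifth is `‖x‖² - 2 (ε V + B) · u`.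

The direction `u` is not contained in any plane (`not_planar`): the last two constants
give quadrics of the shape `α (V · u)² + l · u = const`, and at least one of them has `α ≠ 0`. On a
planar curve this forces `V · u` and then `C · u` to be constant, so that `C` is parallel to `V`, and
then the last constant forces `B · u` to be constant, although `V` and `B` are independent.

A half-turn takes `b + t d` to `x + t u` for all `t` exactly if its axis is parallel to `u + d` (for
`u ≠ -d`) and passes through the midpoint of `b` and `x`, which requires
`(x - b) · (u + d) = 0`. This condition is also sufficient for a line-symmetric motion, the analytic
one being obtained by dividing `u + d` by a power of the parameter at its zeros
(`mem_lineSymmetricPlacements_iff`). After substitution of `x = C - T u` the condition is an affine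
equation for `u`, so by nonplanarity it holds throughout exactly if `b = M₅ - Tᵀ d` and
`d` lies on the quadric `(a₄ - a_r) (v · d)² + C · d = p₅ - a_r` with `v = V / ‖V‖`. The set of
placements is thus the graph of an affine map over the intersection `Z` of this quadric with the unit
sphere. `Z` contains the nonconstant curve `-u`. If `a₄ ≠ a_r`, it is an algebraic curve, of
dimension one. If `a₄ = a_r`, the quadric equation for `-u` is linear, whence `C = 0` and `p₅ = a_r`
by nonplanarity, and `Z` is the whole sphere.
-/

/-! ### Vectors in Euclidean three-space -/

lemma E3.inner_eq (x y : E3) : inner ℝ x y = x 0 * y 0 + x 1 * y 1 + x 2 * y 2 := by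
  simp [PiLp.inner_apply, Fin.sum_univ_three, mul_comm]

lemma E3.norm_sq_eq (x : E3) : ‖x‖ ^ 2 = x 0 ^ 2 + x 1 ^ 2 + x 2 ^ 2 := by
  rw [← real_inner_self_eq_norm_sq, E3.inner_eq]; ring

@[simp] lemma cross_apply_zero (x y : E3) : cross x y 0 = x 1 * y 2 - x 2 * y 1 := by
  simp [cross, cross_apply]

@[simp] lemma cross_apply_one (x y : E3) : cross x y 1 = x 2 * y 0 - x 0 * y 2 := by
  simp [cross, cross_apply]

@[simp] lemma cross_apply_two (x y : E3) : cross x y 2 = x 0 * y 1 - x 1 * y 0 := by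
  simp [cross, cross_apply]

lemma E3.ext {x y : E3} (h0 : x 0 = y 0) (h1 : x 1 = y 1) (h2 : x 2 = y 2) : x = y := by
  ext i; fin_cases i <;> assumption

/-- The Gram determinant of three vectors is the square of their triple product. -/
lemma inner_cross_sq (m v u : E3) :
    inner ℝ (cross m v) u ^ 2 = ‖m‖ ^ 2 * ‖v‖ ^ 2 * ‖u‖ ^ 2
      + 2 * inner ℝ m v * inner ℝ v u * inner ℝ m u - ‖m‖ ^ 2 * inner ℝ v u ^ 2
      - ‖v‖ ^ 2 * inner ℝ m u ^ 2 - ‖u‖ ^ 2 * inner ℝ m v ^ 2 := by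
  simp only [E3.norm_sq_eq, E3.inner_eq, cross_apply_zero, cross_apply_one, cross_apply_two]
  ring

/-- The expansion of a vector `l` in the frame `m, v, m × v`. -/
lemma norm_cross_sq_mul_inner (m v l u : E3) :
    ‖cross m v‖ ^ 2 * inner ℝ l u = inner ℝ l (cross m v) * inner ℝ (cross m v) u
      + (inner ℝ l m * ‖v‖ ^ 2 - inner ℝ l v * inner ℝ m v) * inner ℝ m u
      + (inner ℝ l v * ‖m‖ ^ 2 - inner ℝ l m * inner ℝ m v) * inner ℝ v u := by
  simp only [E3.norm_sq_eq, E3.inner_eq, cross_apply_zero, cross_apply_one, cross_apply_two]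
  ring

lemma norm_sq_smul_eq_of_cross_eq_zero {m v : E3} (h : cross m v = 0) :
    ‖v‖ ^ 2 • m = inner ℝ m v • v := by
  have h0 := cross_apply_zero m v
  have h1 := cross_apply_one m v
  have h2 := cross_apply_two m v
  rw [h] at h0 h1 h2
  simp only [PiLp.zero_apply] at h0 h1 h2
  apply E3.ext <;> simp only [E3.inner_eq, E3.norm_sq_eq, PiLp.smul_apply, smul_eq_mul]
  · linear_combination v 2 * h1 - v 1 * h2
  · linear_combination -v 2 * h0 + v 0 * h2
  · linear_combination v 1 * h0 - v 0 * h1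

lemma norm_cross_sq (m v : E3) : ‖cross m v‖ ^ 2 = ‖m‖ ^ 2 * ‖v‖ ^ 2 - inner ℝ m v ^ 2 := by
  simp only [E3.norm_sq_eq, E3.inner_eq, cross_apply_zero, cross_apply_one, cross_apply_two]
  ring

/-- A vector orthogonal to three pairwise orthogonal nonzero vectors vanishes. -/
lemma eq_zero_of_inner_orthogonal {V A B w : E3} (hV : V ≠ 0) (hA : A ≠ 0) (hB : B ≠ 0)
    (hVA : inner ℝ V A = 0) (hVB : inner ℝ V B = 0) (hAB : inner ℝ A B = 0)
    (wV : inner ℝ V w = 0) (wA : inner ℝ A w = 0) (wB : inner ℝ B w = 0) : w = 0 := by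
  have h1 := inner_cross_sq A B V
  have h2 := inner_cross_sq A B w
  have h3 := norm_cross_sq_mul_inner A B V w
  rw [real_inner_comm] at hVA hVB
  simp only [hAB, hVA, hVB, wV, wA, wB] at h1 h2 h3
  have hq : inner ℝ (cross A B) V ≠ 0 := by
    intro h0
    rw [h0] at h1
    have : ‖A‖ ^ 2 * ‖B‖ ^ 2 * ‖V‖ ^ 2 ≠ 0 := by positivity
    exact this (by linear_combination -h1)
  have hw : inner ℝ (cross A B) w = 0 := by
    rw [real_inner_comm] at hq
    refine (mul_eq_zero.1 ?_).resolve_left hq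
    linear_combination -h3
  rw [hw] at h2
  by_contra hw0
  have : ‖A‖ ^ 2 * ‖B‖ ^ 2 * ‖w‖ ^ 2 ≠ 0 := by positivity
  exact this (by linear_combination -h2)

/-! ### Half-turns in Study parameters -/

/-- The half-turn about the line through `G` with direction `g`. -/
noncomputable def halfTurn (g G m : E3) : E3 := (2 : ℝ) • G - m + (2 * inner ℝ g (m - G) / ‖g‖ ^ 2) • g

lemma studyN_vec (g : E3) : studyN ![0, g 0, g 1, g 2] = ‖g‖ ^ 2 := by
  simp [studyN, E3.norm_sq_eq]

/-- The half-turn about the line through `G` with direction `g` has the Study parameters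
`(0, g)` and `(0, g × G)`. -/
lemma studyMap_halfTurn {g : E3} (hg : g ≠ 0) (G m : E3) :
    studyMap ![0, g 0, g 1, g 2] ![0, cross g G 0, cross g G 1, cross g G 2] m
 = halfTurn g G m := by
  have hN : ‖g‖ ^ 2 ≠ 0 := by positivity
  rw [halfTurn, studyMap, studyN_vec]
  rw [E3.norm_sq_eq] at *
  apply E3.ext <;>
  · simp [studyRot, studyTrans, dotProduct, Fin.sum_univ_three, E3.inner_eq]
    field_simp
    ring

lemma lineReflection_eq_halfTurn (G v m : E3) : lineReflection G v m = halfTurn v G m := by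
  rw [halfTurn, lineReflection, Submodule.reflection_apply, Submodule.starProjection_singleton]
  simp only [RCLike.ofReal_real_eq_id, id]
  match_scalars <;> ring

lemma isLineReflection_of {e f : Fin 4 → ℝ} (h : IsStudy e f) (he : e 0 = 0) (hf : f 0 = 0) :
    IsLineReflection e f := by
  refine ⟨h, he, hf, fun m => ?_⟩
  obtain ⟨h1, hN⟩ := h
  have hN' : ‖vecPart e‖ ^ 2 = studyN e := by
    rw [E3.norm_sq_eq]; simp [vecPart, studyN, he]
  rw [lineReflection_eq_halfTurn, halfTurn, hN', studyMap]
  rw [he, hf] at h1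
  have hN2 : studyN e = e 1 ^ 2 + e 2 ^ 2 + e 3 ^ 2 := by simp [studyN, he]
  rw [hN2] at hN ⊢
  apply E3.ext <;>
  · simp [studyRot, studyTrans, dotProduct, Fin.sum_univ_three, E3.inner_eq, vecPart,
      he, hf]
    field_simp
    ring

lemma isLineReflection_halfTurn {g : E3} (hg : g ≠ 0) (G : E3) :
    IsLineReflection ![0, g 0, g 1, g 2] ![0, cross g G 0, cross g G 1, cross g G 2] := by
  refine isLineReflection_of ⟨?_, ?_⟩ rfl rfl
  · simp; ring
  · rw [studyN_vec]; positivity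

lemma studyMap_add_smul (e f : Fin 4 → ℝ) (a b : E3) (t : ℝ) :
    studyMap e f (a + t • b) = studyMap e f a + t • (studyMap e f (a + b) - studyMap e f a) := by
  apply E3.ext <;>
  · simp [studyMap, studyRot, studyTrans, dotProduct, Fin.sum_univ_three]
    ring

lemma norm_studyMap_sub {e f : Fin 4 → ℝ} (h : IsStudy e f) (a b : E3) :
    ‖studyMap e f a - studyMap e f b‖ = ‖a - b‖ := by
  rw [← sq_eq_sq₀ (norm_nonneg _) (norm_nonneg _), E3.norm_sq_eq, E3.norm_sq_eq]
  have hN := h.2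
  simp [studyMap, studyRot, studyTrans, dotProduct, Fin.sum_univ_three]
  field_simp
  unfold studyN
  ring

namespace LinearPentapod
variable (L : LinearPentapod)

lemma studyMap_point (e f : Fin 4 → ℝ) (t : ℝ) :
    studyMap e f (L.point t) = studyMap e f (L.point 0) + t • L.dirImage e f := by
  simpa [point, dirImage] using studyMap_add_smul e f L.org L.dir t

lemma norm_dirImage {e f : Fin 4 → ℝ} (h : IsStudy e f) : ‖L.dirImage e f‖ = 1 := by
  rw [dirImage, norm_studyMap_sub h]
  simp [point, L.norm_dir]

end LinearPentapod

/-! ### Line-symmetric motions through a given motion of a line -/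

lemma exists_ne_zero_orthogonal (a b : E3) : ∃ g : E3, g ≠ 0 ∧ inner ℝ a g = 0 ∧ inner ℝ b g = 0 := by
  classical
  set K : Submodule ℝ E3 := Submodule.span ℝ (({a, b} : Finset E3) : Set E3) with hK
  have hle : Module.finrank ℝ K ≤ 2 :=
    (finrank_span_finset_le_card _).trans Finset.card_le_two
  have hne : Kᗮ ≠ ⊥ := by
    rw [Ne, Submodule.orthogonal_eq_bot_iff]
    intro htop
    rw [htop, finrank_top, finrank_euclideanSpace, Fintype.card_fin] at hle
    omega
  obtain ⟨g, hg, hg0⟩ := Submodule.exists_mem_ne_zero_of_ne_bot hne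
  rw [Submodule.mem_orthogonal] at hg
  exact ⟨g, hg0, hg a (Submodule.subset_span (by simp)), hg b (Submodule.subset_span (by simp))⟩

lemma halfTurn_smul {c : ℝ} (hc : c ≠ 0) (g G m : E3) :
    halfTurn (c • g) G m = halfTurn g G m := by
  rcases eq_or_ne g 0 with rfl | hg
  · simp
  have : ‖g‖ ≠ 0 := by simpa
  rw [halfTurn, halfTurn, smul_smul, norm_smul, real_inner_smul_left, mul_pow, Real.norm_eq_abs,
    sq_abs]
  congr 2
  field_simp

lemma analyticAt_inner {p q : ℝ → E3} {s : ℝ} (hp : AnalyticAt ℝ p s) (hq : AnalyticAt ℝ q s) :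
    AnalyticAt ℝ (fun r => inner ℝ (p r) (q r)) s :=
  ((innerSL ℝ : E3 →L[ℝ] E3 →L[ℝ] ℝ).analyticAt_bilinear (p s, q s)).comp₂ hp hq

lemma analyticAt_halfTurn {g G : ℝ → E3} {s : ℝ} (hg : AnalyticAt ℝ g s) (hG : AnalyticAt ℝ G s)
    (h0 : g s ≠ 0) (m : E3) : AnalyticAt ℝ (fun r => halfTurn (g r) (G r) m) s := by
  have h1 : AnalyticAt ℝ (fun r => 2 * inner ℝ (g r) (m - G r)) s :=
    analyticAt_const.mul (analyticAt_inner hg (analyticAt_const.sub hG))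
  have h2 : AnalyticAt ℝ (fun r => ‖g r‖ ^ 2) s := by
    simp_rw [← real_inner_self_eq_norm_sq]
    exact analyticAt_inner hg hg
  have h3 : ‖g s‖ ^ 2 ≠ 0 := by simpa
  have h4 : AnalyticAt ℝ (fun r => (2 : ℝ) • G r - m) s :=
    (AnalyticAt.const_smul (c := (2 : ℝ)) hG).sub analyticAt_const
  exact h4.add ((h1.div h2 h3).smul hg)

/-- A half-turn that takes the direction `d` to `u`, and whose axis meets the segment from `b` to
`x` orthogonally in its midpoint, takes the line `b + t d` to the line `x + t u`. -/
lemma halfTurn_line {g x b u d : E3} (hx : inner ℝ (x - b) g = 0)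
    (hd : (2 * inner ℝ g d / ‖g‖ ^ 2) • g = u + d) (t : ℝ) :
    halfTurn g ((1 / 2 : ℝ) • (x + b)) (b + t • d) = x + t • u := by
  have h1 : inner ℝ g (b + t • d - (1 / 2 : ℝ) • (x + b)) = t * inner ℝ g d := by
    rw [show b + t • d - (1 / 2 : ℝ) • (x + b) = t • d - (1 / 2 : ℝ) • (x - b) by module,
      inner_sub_right, real_inner_smul_right, real_inner_smul_right, real_inner_comm (x - b) g, hx]
    ring
  rw [halfTurn, h1, show 2 * (t * inner ℝ g d) / ‖g‖ ^ 2 = t * (2 * inner ℝ g d / ‖g‖ ^ 2) by ring,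
    mul_smul, hd]
  module

lemma halfTurn_dir_of_add {u d : E3} (hu : ‖u‖ = 1) (hd : ‖d‖ = 1) (h : u + d ≠ 0) :
    (2 * inner ℝ (u + d) d / ‖u + d‖ ^ 2) • (u + d) = u + d := by
  have h0 : ‖u + d‖ ^ 2 ≠ 0 := by simpa
  have : 2 * inner ℝ (u + d) d = ‖u + d‖ ^ 2 := by
    rw [norm_add_sq_real, inner_add_left, real_inner_self_eq_norm_sq, hu, hd]
    ring
  rw [this, div_self h0, one_smul]

/-- If `u` moves analytically on the unit sphere and is not locally constantly `-d`, the direction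
of the vector `u + d` extends analytically over a zero of it. The extended direction is still that
of a half-turn axis for the pair `(x, u)`. -/
lemma exists_analytic_axis {u x : ℝ → E3} {b d : E3} {s : ℝ} (hu : AnalyticAt ℝ u s)
    (hx : AnalyticAt ℝ x s) (hn : ∀ᶠ r in nhds s, ‖u r‖ = 1) (hd : ‖d‖ = 1)
    (hor : ∀ᶠ r in nhds s, inner ℝ (x r - b) (u r + d) = 0)
    (hne : ¬ ∀ᶠ r in nhds s, u r + d = 0) (hs : u s + d = 0) :
    ∃ h : ℝ → E3, AnalyticAt ℝ h s ∧ h s ≠ 0 ∧ inner ℝ (x s - b) (h s) = 0 ∧ inner ℝ (h s) d = 0 ∧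
      ∃ n : ℕ, ∀ᶠ r in nhds s, u r + d = (r - s) ^ n • h r := by
  have ha : AnalyticAt ℝ (fun r => u r + d) s := hu.add analyticAt_const
  obtain ⟨n, h, hh, hh0, hev⟩ := ha.exists_eventuallyEq_pow_smul_nonzero_iff.2 hne
  have hn0 : n ≠ 0 := by
    rintro rfl
    have := hev.self_of_nhds
    simp [hs] at this
    exact hh0 this.symm
  have hpow : ∀ r, r ≠ s → (r - s) ^ n ≠ 0 := fun r hr => pow_ne_zero _ (sub_ne_zero.2 hr)
  have hc1 : ContinuousAt (fun r => inner ℝ (x r - b) (h r)) s := by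
    have h1 := hx.continuousAt
    have h2 := hh.continuousAt
    fun_prop
  have hc2 : ContinuousAt (fun r => 2 * inner ℝ (h r) d - (r - s) ^ n * ‖h r‖ ^ 2) s := by
    have := hh.continuousAt
    fun_prop
  have e1 : ∀ᶠ r in nhdsWithin s {s}ᶜ, inner ℝ (x r - b) (h r) = 0 := by
    filter_upwards [hor.filter_mono nhdsWithin_le_nhds, hev.filter_mono nhdsWithin_le_nhds,
      self_mem_nhdsWithin] with r h1 h2 h3
    rw [h2, real_inner_smul_right] at h1
    exact (mul_eq_zero.1 h1).resolve_left (hpow r h3)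
  have e2 : ∀ᶠ r in nhdsWithin s {s}ᶜ, 2 * inner ℝ (h r) d - (r - s) ^ n * ‖h r‖ ^ 2 = 0 := by
    filter_upwards [hn.filter_mono nhdsWithin_le_nhds, hev.filter_mono nhdsWithin_le_nhds,
      self_mem_nhdsWithin] with r h1 h2 h3
    have h4 : u r = (r - s) ^ n • h r - d := by rw [← h2]; abel
    have h5 : ‖u r‖ ^ 2 = 1 := by rw [h1]; norm_num
    rw [h4, norm_sub_sq_real, hd, norm_smul, real_inner_smul_left, mul_pow, Real.norm_eq_abs,
      sq_abs] at h5
    have := hpow r h3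
    apply mul_left_cancel₀ this
    linear_combination -h5
  refine ⟨h, hh, hh0, ?_, ?_, n, hev⟩
  · refine tendsto_nhds_unique (hc1.tendsto.mono_left nhdsWithin_le_nhds) ?_ (l := nhdsWithin s {s}ᶜ)
    exact tendsto_const_nhds.congr' (e1.mono fun r hr => hr.symm)
  · have := tendsto_nhds_unique (hc2.tendsto.mono_left nhdsWithin_le_nhds)
      (tendsto_const_nhds.congr' (e2.mono fun r hr => hr.symm)) (l := nhdsWithin s {s}ᶜ)
    simp [hn0] at this
    exact this

namespace LinearPentapod
variable (L : LinearPentapod)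

lemma IsSelfMotion.continuousOn_dirImage {L : LinearPentapod} {I : Set ℝ} {e f : ℝ → Fin 4 → ℝ}
    (h : L.IsSelfMotion I e f) : ContinuousOn (fun s => L.dirImage (e s) (f s)) I :=
  (h.continuous _).sub (h.continuous _)

/-- A placement `b + t d` belongs to a line-symmetric motion generating the motion `x + t u` of `p`
if and only if `x - b` and `u + d` are orthogonal throughout. -/
theorem mem_lineSymmetricPlacements_iff {I : Set ℝ} {e f : ℝ → Fin 4 → ℝ}
    (h : L.IsSelfMotion I e f)
    (hmove : ∃ s ∈ I, ∃ s' ∈ I, L.dirImage (e s) (f s) ≠ L.dirImage (e s') (f s')) (b d : E3) :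
    (b, d) ∈ L.lineSymmetricPlacements I e f ↔ ‖d‖ = 1 ∧ ∀ s ∈ I,
      inner ℝ (studyMap (e s) (f s) (L.point 0) - b) (L.dirImage (e s) (f s) + d) = 0 := by
  set x : ℝ → E3 := fun s => studyMap (e s) (f s) (L.point 0) with hxdef
  set u : ℝ → E3 := fun s => L.dirImage (e s) (f s) with hudef
  have hun : ∀ s ∈ I, ‖u s‖ = 1 := fun s hs => L.norm_dirImage (h.study s hs)
  constructor
  · rintro ⟨hd, e', f', hrefl, hline, -, -⟩
    refine ⟨hd, fun s hs => ?_⟩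
    obtain ⟨-, -, -, hr⟩ := hrefl s hs
    have hN : vecPart (e' s) ≠ 0 := by
      intro h0
      have h1 := (hrefl s hs).1.2
      have h2 : ‖vecPart (e' s)‖ ^ 2 = studyN (e' s) := by
        rw [E3.norm_sq_eq]; simp [vecPart, studyN, (hrefl s hs).2.1]
      rw [← h2, h0] at h1
      simp at h1
    have l0 := hline s hs 0
    have l1 := hline s hs 1
    simp only [zero_smul, add_zero, one_smul] at l0 l1
    rw [L.studyMap_point, hr, lineReflection_eq_halfTurn, halfTurn] at l0 l1
    set v := vecPart (e' s)
    set G := (studyN (e' s))⁻¹ • cross (vecPart (f' s)) v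
    have hx0 : x s = (2 : ℝ) • G - b + (2 * inner ℝ v (b - G) / ‖v‖ ^ 2) • v := by
      rw [l0]; simp [x]
    have hu0 : u s + d = (2 * inner ℝ v d / ‖v‖ ^ 2) • v := by
      have h1 : u s = (x s + u s) - x s := by abel
      have h2 : x s + u s = (2 : ℝ) • G - (b + d) + (2 * inner ℝ v (b + d - G) / ‖v‖ ^ 2) • v := by
        rw [l1]; simp [x, u]
      rw [h1, h2, hx0, show b + d - G = (b - G) + d by abel, inner_add_right]
      module
    have hv : ‖v‖ ^ 2 ≠ 0 := by simpa
    have hxv : inner ℝ (x s - b) v = 0 := by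
      rw [hx0, show (2 : ℝ) • G - b + (2 * inner ℝ v (b - G) / ‖v‖ ^ 2) • v - b
        = (2 * inner ℝ v (b - G) / ‖v‖ ^ 2) • v - (2 : ℝ) • (b - G) by module, inner_sub_left,
        real_inner_smul_left, real_inner_smul_left, real_inner_self_eq_norm_sq,
        real_inner_comm v (b - G)]
      field_simp
      ring
    rw [hu0, real_inner_smul_right, hxv, mul_zero]
  · rintro ⟨hd, hor⟩
    -- a suitable direction of the axis at every instant
    have key : ∀ s ∈ I, ∃ g : E3, g ≠ 0 ∧ inner ℝ (x s - b) g = 0 ∧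
        (2 * inner ℝ g d / ‖g‖ ^ 2) • g = u s + d ∧ (u s ≠ -d → g = u s + d) ∧
        (AnalyticOnNhd ℝ x I → AnalyticOnNhd ℝ u I → ∃ k : ℝ → E3, AnalyticAt ℝ k s ∧ k s = g ∧
          ∃ n : ℕ, ∀ᶠ r in nhds s, u r + d = (r - s) ^ n • k r) := by
      intro s hs
      by_cases hsd : u s + d = 0
      · have hsd' : u s = -d := eq_neg_of_add_eq_zero_left hsd
        by_cases han : AnalyticOnNhd ℝ x I ∧ AnalyticOnNhd ℝ u I
        · obtain ⟨hax, hau⟩ := han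
          have hI := h.isOpen.mem_nhds hs
          obtain ⟨k, hk, hk0, hkx, hkd, n, hkn⟩ := exists_analytic_axis (b := b) (d := d)
            (hau s hs) (hax s hs) (Filter.mem_of_superset hI hun) hd
            (Filter.mem_of_superset hI hor) (fun hev => by
              have hall : Set.EqOn u (fun _ => -d) I :=
                hau.eqOn_of_preconnected_of_eventuallyEq analyticOnNhd_const
                  h.ordConnected.isPreconnected hs
                  (hev.mono fun r hr => eq_neg_of_add_eq_zero_left hr)
              obtain ⟨s1, h1, s2, h2, hne⟩ := hmove
              exact hne ((hall h1).trans (hall h2).symm)) hsd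
          exact ⟨k s, hk0, hkx, by simp [hkd, hsd], fun hne => (hne hsd').elim,
            fun _ _ => ⟨k, hk, rfl, n, hkn⟩⟩
        · obtain ⟨g, hg0, hgx, hgd⟩ := exists_ne_zero_orthogonal (x s - b) d
          refine ⟨g, hg0, hgx, ?_, fun hne => (hne hsd').elim, fun h1 h2 => (han ⟨h1, h2⟩).elim⟩
          rw [real_inner_comm, hgd, hsd]; simp
      · exact ⟨u s + d, hsd, hor s hs, halfTurn_dir_of_add (hun s hs) hd hsd, fun _ => rfl,
          fun _ hau => ⟨fun r => u r + d, (hau s hs).add analyticAt_const, rfl, 0, by simp⟩⟩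
    choose! g hg0 hgx hgd hgu hga using key
    set G : ℝ → E3 := fun s => (1 / 2 : ℝ) • (x s + b) with hG
    have hmap : ∀ s ∈ I, ∀ m, studyMap ![0, g s 0, g s 1, g s 2]
        ![0, cross (g s) (G s) 0, cross (g s) (G s) 1, cross (g s) (G s) 2] m
          = halfTurn (g s) (G s) m := fun s hs m => studyMap_halfTurn (hg0 s hs) _ _
    have hxc : ContinuousOn x I := h.continuous _
    have huc : ContinuousOn u I := h.continuousOn_dirImage
    refine ⟨hd, fun s => ![0, g s 0, g s 1, g s 2],
      fun s => ![0, cross (g s) (G s) 0, cross (g s) (G s) 1, cross (g s) (G s) 2],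
      fun s hs => isLineReflection_halfTurn (hg0 s hs) _, ?_, ?_, ?_⟩
    · intro s hs t
      rw [hmap s hs, L.studyMap_point]
      exact halfTurn_line (hgx s hs) (hgd s hs) t
    · intro m
      have hc : ContinuousOn (fun s => halfTurn (u s + d) (G s) m) {s ∈ I | u s ≠ -d} := by
        have h1 : ContinuousOn x {s ∈ I | u s ≠ -d} := hxc.mono fun s hs => hs.1
        have h2 : ContinuousOn u {s ∈ I | u s ≠ -d} := huc.mono fun s hs => hs.1
        unfold halfTurn
        simp only [hG]
        have : ∀ s ∈ {s ∈ I | u s ≠ -d}, ‖u s + d‖ ^ 2 ≠ 0 := fun s hs => by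
          have : u s + d ≠ 0 := fun h0 => hs.2 (eq_neg_of_add_eq_zero_left h0)
          simpa
        fun_prop (disch := assumption)
      refine hc.congr fun s hs => ?_
      simp only
      rw [hmap s hs.1, hgu s hs.1 hs.2]
    · intro han m s hs
      have hax : AnalyticOnNhd ℝ x I := han 0
      have hau : AnalyticOnNhd ℝ u I := (han 1).sub (han 0)
      obtain ⟨k, hk, hks, n, hkn⟩ := hga s hs hax hau
      have hk0 : k s ≠ 0 := hks ▸ hg0 s hs
      have hGa : AnalyticAt ℝ G s :=
        AnalyticAt.const_smul (c := (1 / 2 : ℝ)) ((hax s hs).add (analyticAt_const (v := b)))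
      have hform := analyticAt_halfTurn hk hGa hk0 m
      refine hform.congr ?_
      filter_upwards [hkn, h.isOpen.mem_nhds hs, hk.continuousAt.eventually_ne hk0] with r h1 h2 h3
      rw [hmap r h2]
      rcases eq_or_ne r s with rfl | hrs
      · rw [hks]
      · have hp : (r - s) ^ n ≠ 0 := pow_ne_zero _ (sub_ne_zero.2 hrs)
        have hud : u r ≠ -d := by
          intro h0
          rw [h0, neg_add_cancel] at h1
          exact (smul_ne_zero hp h3) h1.symm
        rw [hgu r h2 hud, h1, halfTurn_smul hp]

end LinearPentapod

/-! ### The normal form of both types -/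

namespace LinearPentapod

lemma eval_of_natDegree_le_three {q : ℝ[X]} (h : q.natDegree ≤ 3) (t : ℝ) :
    q.eval t = q.coeff 0 + q.coeff 1 * t + q.coeff 2 * t ^ 2 + q.coeff 3 * t ^ 3 := by
  rw [eval_eq_sum_range' (Nat.lt_succ_of_le h)]
  simp [Finset.sum_range_succ]

lemma cval_of_natDegree_le_three {q : ℝ[X]} (h : q.natDegree ≤ 3) (a_r a_c : ℝ) :
    cval q a_r a_c =
      ⟨q.coeff 0 + q.coeff 1 * a_r + q.coeff 2 * (a_r ^ 2 - a_c ^ 2)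
          + q.coeff 3 * (a_r ^ 3 - 3 * a_r * a_c ^ 2),
        a_c * (q.coeff 1 + 2 * q.coeff 2 * a_r + q.coeff 3 * (3 * a_r ^ 2 - a_c ^ 2))⟩ := by
  rw [cval, aeval_eq_sum_range' (Nat.lt_succ_of_le h)]
  apply Complex.ext <;>
  · simp [Finset.sum_range_succ, pow_succ, -mul_eq_mul_left_iff, -mul_eq_mul_right_iff]
    ring

/-- The linear independence of the five rows `(1, t, 1/D, (t - a_r)/D, c)` with
`D = (t - a_r)² + a_c²`, stated as injectivity of the matrix they form. -/
def RowsNondegenerate (a_r a_c : ℝ) (t c : Fin 5 → ℝ) : Prop :=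
  ∀ X : Fin 5 → ℝ, (∀ i, X 0 + X 1 * t i + X 2 * (1 / ((t i - a_r) ^ 2 + a_c ^ 2))
    + X 3 * ((t i - a_r) / ((t i - a_r) ^ 2 + a_c ^ 2)) + X 4 * c i = 0) → X = 0

/-- The common normal form of both types. The base points are
`M₅ + (A + (t - a_r) B) / ((t - a_r)² + a_c²) + c V`, the partial fraction decomposition of `σ`,
with `c (t - a₄) = ε`. In type 1 `ε = 1`; in type 2 `ε = 0`, so that `c` vanishes outside
`t = a₄` and is arbitrary for the legs through the point with this coordinate. -/
structure HasNormalForm (L : LinearPentapod) (a₄ a_r a_c : ℝ) (M₅ V A B : E3) (ε : ℝ)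
    (c : Fin 5 → ℝ) : Prop where
  a_c_ne : a_c ≠ 0
  V_ne : V ≠ 0
  B_ne : B ≠ 0
  inner_V_A : inner ℝ V A = 0
  inner_V_B : inner ℝ V B = 0
  inner_A_B : inner ℝ A B = 0
  norm_A : ‖A‖ ^ 2 = a_c ^ 2 * ‖B‖ ^ 2
  c_mul : ∀ i, c i * (L.coord i - a₄) = ε
  base_eq : ∀ i, L.base i = M₅ + (1 / ((L.coord i - a_r) ^ 2 + a_c ^ 2)) • A
    + ((L.coord i - a_r) / ((L.coord i - a_r) ^ 2 + a_c ^ 2)) • B + c i • V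
  rows : RowsNondegenerate a_r a_c L.coord c

/-- Partial fractions: a cubic polynomial is determined by its leading coefficient and its values
at `a₄` and at `a_r + i a_c`, here `v` and `P + i Q`. -/
lemma cubic_partialFraction {k0 k1 k2 k3 a₄ a_r a_c v P Q : ℝ} (hac : a_c ≠ 0)
    (hv : k0 + k1 * a₄ + k2 * a₄ ^ 2 + k3 * a₄ ^ 3 = v)
    (hP : k0 + k1 * a_r + k2 * (a_r ^ 2 - a_c ^ 2) + k3 * (a_r ^ 3 - 3 * a_r * a_c ^ 2) = P)
    (hQ : a_c * (k1 + 2 * k2 * a_r + k3 * (3 * a_r ^ 2 - a_c ^ 2)) = Q) (t : ℝ) :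
    k0 + k1 * t + k2 * t ^ 2 + k3 * t ^ 3 = k3 * ((t - a₄) * ((t - a_r) ^ 2 + a_c ^ 2))
      + v / ((a₄ - a_r) ^ 2 + a_c ^ 2) * ((t - a_r) ^ 2 + a_c ^ 2)
      + (t - a₄) * ((P * (a_r - a₄) + Q * a_c) / ((a₄ - a_r) ^ 2 + a_c ^ 2)
        + (t - a_r) * ((Q * (a_r - a₄) - P * a_c) / (a_c * ((a₄ - a_r) ^ 2 + a_c ^ 2)))) := by
  subst hv hP hQ
  have : (a₄ - a_r) ^ 2 + a_c ^ 2 ≠ 0 := by positivity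
  field_simp
  ring

lemma rowsNondegenerate_of_injective {a₄ a_r a_c : ℝ} {t c : Fin 5 → ℝ} (hac : a_c ≠ 0)
    (ht : Function.Injective t) (hc : ∀ i, c i * (t i - a₄) = 1) :
    RowsNondegenerate a_r a_c t c := by
  intro Y hY
  set p : ℝ[X] := (C (Y 0) + C (Y 1) * X) * (X - C a₄) * ((X - C a_r) ^ 2 + C (a_c ^ 2))
    + (C (Y 2) + C (Y 3) * (X - C a_r)) * (X - C a₄) + C (Y 4) * ((X - C a_r) ^ 2 + C (a_c ^ 2))
    with hp
  have hdeg : p.natDegree < Fintype.card (Fin 5) := by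
    have : p.natDegree ≤ 4 := by rw [hp]; compute_degree
    simpa using Nat.lt_succ_of_le this
  have hD : ∀ r : ℝ, (r - a_r) ^ 2 + a_c ^ 2 ≠ 0 := fun r => by positivity
  have hp0 : p = 0 := by
    refine eq_zero_of_natDegree_lt_card_of_eval_eq_zero p ht (fun i => ?_) hdeg
    have h1 := hY i
    have h2 := hD (t i)
    have h3 := hc i
    simp only [hp, eval_add, eval_mul, eval_sub, eval_C, eval_X, eval_pow]
    field_simp at h1
    linear_combination (t i - a₄) * h1 - Y 4 * ((t i - a_r) ^ 2 + a_c ^ 2) * h3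
  have hev : ∀ r, (Y 0 + Y 1 * r) * (r - a₄) * ((r - a_r) ^ 2 + a_c ^ 2)
      + (Y 2 + Y 3 * (r - a_r)) * (r - a₄) + Y 4 * ((r - a_r) ^ 2 + a_c ^ 2) = 0 := fun r => by
    have : p.eval r = 0 := by rw [hp0, eval_zero]
    simpa [hp] using this
  have h4 : Y 4 = 0 := by
    have := hev a₄
    simpa [hD a₄] using this
  have e1 := hev (a₄ + 1)
  have e2 := hev (a₄ + 2)
  have e3 := hev (a₄ + 3)
  have e4 := hev (a₄ + 4)
  rw [h4] at e1 e2 e3 e4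
  have h1 : Y 1 = 0 := by linear_combination e4 / 24 - e3 / 6 + e2 / 4 - e1 / 6
  rw [h1] at e1 e2 e3 e4
  have h0 : Y 0 = 0 := by linear_combination e3 / 6 - e2 / 2 + e1 / 2
  rw [h0] at e1 e2 e3 e4
  have h3 : Y 3 = 0 := by linear_combination e2 / 2 - e1
  rw [h3] at e1
  have h2 : Y 2 = 0 := by linear_combination e1
  ext i; fin_cases i <;> simpa

/-- In type 2 the Plücker coordinates of the legs depend linearly on the rows
`(1, t, 1/D, (t - a_r)/D, c)`, in every pose. Linearly dependent rows would therefore make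
the pentapod architecturally singular. -/
lemma rowsNondegenerate_of_not_singular {L : LinearPentapod} {a₄ a_r a_c : ℝ} {M₅ V A B : E3}
    {c : Fin 5 → ℝ} (hac : a_c ≠ 0) (hc : ∀ i, c i * (L.coord i - a₄) = 0)
    (hb : ∀ i, L.base i = M₅ + (1 / ((L.coord i - a_r) ^ 2 + a_c ^ 2)) • A
      + ((L.coord i - a_r) / ((L.coord i - a_r) ^ 2 + a_c ^ 2)) • B + c i • V)
    (hs : ¬ L.IsArchitecturallySingular) : RowsNondegenerate a_r a_c L.coord c := by
  by_contra hrows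
  apply hs
  intro x u _ hli
  unfold RowsNondegenerate at hrows
  push Not at hrows
  obtain ⟨Y, hY, hY0⟩ := hrows
  set t := L.coord
  set R : Matrix (Fin 5) (Fin 5) ℝ := Matrix.of fun i => ![1, t i,
    1 / ((t i - a_r) ^ 2 + a_c ^ 2), (t i - a_r) / ((t i - a_r) ^ 2 + a_c ^ 2), c i] with hR
  have hdet : R.det = 0 := Matrix.exists_mulVec_eq_zero_iff.1 ⟨Y, hY0, by
    ext i
    have := hY i
    simp only [Matrix.mulVec, dotProduct, Fin.sum_univ_five, hR, Matrix.of_apply, Pi.zero_apply]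
    simp only [Matrix.cons_val]
    linear_combination this⟩
  obtain ⟨l, hl0, hl⟩ := Matrix.exists_vecMul_eq_zero_iff.2 hdet
  have hsum : ∀ j, ∑ i, l i * R i j = 0 := fun j => congrFun hl j
  apply hl0
  refine funext (Fintype.linearIndependent_iff.1 hli l ?_)
  have hD : ∀ r : ℝ, (r - a_r) ^ 2 + a_c ^ 2 ≠ 0 := fun r => by positivity
  have hpl : ∀ i, ((L.base i - (x + t i • u), cross (x + t i • u) (L.base i)) : E3 × E3)
      = R i 0 • (M₅ - x, cross x M₅ + cross u B) + R i 1 • (-u, cross u M₅)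
        + R i 2 • (A, cross x A + a_r • cross u A - a_c ^ 2 • cross u B)
        + R i 3 • (B, cross x B + cross u A + a_r • cross u B)
        + R i 4 • (V, cross x V + a₄ • cross u V) := by
    intro i
    have h1 := hD (t i)
    have h2 := hc i
    have h3 : c i * t i = c i * a₄ := by linear_combination h2
    simp only [hR, Matrix.of_apply, Matrix.cons_val]
    rw [hb]
    refine Prod.ext ?_ ?_
    · simp only [Prod.fst_add, Prod.smul_fst]
      module
    · simp only [Prod.snd_add, Prod.smul_snd]
      apply E3.ext <;>
      · simp
        field_simp
        first
          | linear_combination ((t i - a_r) ^ 2 + a_c ^ 2) * (u 1 * V 2 - u 2 * V 1) * h3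
          | linear_combination ((t i - a_r) ^ 2 + a_c ^ 2) * (u 2 * V 0 - u 0 * V 2) * h3
          | linear_combination ((t i - a_r) ^ 2 + a_c ^ 2) * (u 0 * V 1 - u 1 * V 0) * h3
  simp only [hpl, smul_add, Finset.sum_add_distrib, smul_smul, ← Finset.sum_smul, hsum, zero_smul,
    add_zero]

theorem IsType1.hasNormalForm {L : LinearPentapod} {a₄ a_r a_c : ℝ} {M₅ : E3}
    (h : L.IsType1 a₄ a_r a_c M₅) :
    ∃ V A B ε c, L.HasNormalForm a₄ a_r a_c M₅ V A B ε c := by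
  obtain ⟨w, y, hwd, hyd, hli, hac, hw4, hwc, hiso, hperp, hw3, hM, hleg⟩ := h
  have hDv : (a₄ - a_r) ^ 2 + a_c ^ 2 ≠ 0 := by positivity
  have hD : ∀ r : ℝ, (r - a_r) ^ 2 + a_c ^ 2 ≠ 0 := fun r => by positivity
  set k := w.coeff 3 with hk
  have hw : ∀ t, w.eval t = k * ((t - a₄) * ((t - a_r) ^ 2 + a_c ^ 2)) := fun t => by
    have h1 := cval_of_natDegree_le_three hwd a_r a_c
    rw [hwc] at h1
    have h2 := congrArg Complex.re h1
    have h3 := congrArg Complex.im h1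
    rw [eval_of_natDegree_le_three hwd] at hw4 ⊢
    rw [cubic_partialFraction hac hw4 h2.symm h3.symm]
    simp [hk]
  set P : Fin 3 → ℝ := fun j => (cval (y j) a_r a_c).re with hPdef
  set Q : Fin 3 → ℝ := fun j => (cval (y j) a_r a_c).im with hQdef
  set v : Fin 3 → ℝ := fun j => (y j).eval a₄ with hvdef
  have hPQ : (P 0 ^ 2 + P 1 ^ 2 + P 2 ^ 2 = Q 0 ^ 2 + Q 1 ^ 2 + Q 2 ^ 2) ∧
      P 0 * Q 0 + P 1 * Q 1 + P 2 * Q 2 = 0 := by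
    have h1 := congrArg Complex.re hiso
    have h2 := congrArg Complex.im hiso
    simp [Fin.sum_univ_three, pow_two] at h1 h2
    simp only [hPdef, hQdef]
    constructor <;> linarith
  have hPv : (P 0 * v 0 + P 1 * v 1 + P 2 * v 2 = 0) ∧ Q 0 * v 0 + Q 1 * v 1 + Q 2 * v 2 = 0 := by
    have h1 := congrArg Complex.re hperp
    have h2 := congrArg Complex.im hperp
    simp [Fin.sum_univ_three] at h1 h2
    exact ⟨h1, h2⟩
  set Dv := (a₄ - a_r) ^ 2 + a_c ^ 2 with hDvdef
  set V : E3 := WithLp.toLp 2 fun j => v j / Dv / k with hV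
  set A : E3 := WithLp.toLp 2 fun j => (P j * (a_r - a₄) + Q j * a_c) / Dv / k with hA
  set B : E3 := WithLp.toLp 2 fun j => (Q j * (a_r - a₄) - P j * a_c) / (a_c * Dv) / k with hB
  have hy : ∀ j t, (y j).eval t = k * (M₅ j * ((t - a₄) * ((t - a_r) ^ 2 + a_c ^ 2))
      + V j * ((t - a_r) ^ 2 + a_c ^ 2) + (t - a₄) * (A j + (t - a_r) * B j)) := fun j t => by
    have h1 := cval_of_natDegree_le_three (hyd j) a_r a_c
    have h4 : v j = _ := eval_of_natDegree_le_three (hyd j) a₄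
    have h2 : P j = _ := congrArg Complex.re h1
    have h3 : Q j = _ := congrArg Complex.im h1
    rw [eval_of_natDegree_le_three (hyd j), cubic_partialFraction hac h4.symm h2.symm h3.symm, hM]
    simp only [hV, hA, hB, ← hDvdef]
    field_simp
  obtain ⟨hPQ1, hPQ2⟩ := hPQ
  obtain ⟨hPv1, hPv2⟩ := hPv
  have hnorm : ‖A‖ ^ 2 = a_c ^ 2 * ‖B‖ ^ 2 := by
    simp only [E3.norm_sq_eq, hA, hB]
    field_simp
    linear_combination ((a_r - a₄) ^ 2 - a_c ^ 2) * hPQ1 + 4 * (a_r - a₄) * a_c * hPQ2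
  have hdep : ∀ g : E3, inner ℝ V g = 0 → inner ℝ A g = 0 → inner ℝ B g = 0 → g = 0 := by
    intro g gV gA gB
    rw [E3.inner_eq] at gV gA gB
    have := Fintype.linearIndependent_iff.1 hli ![-(inner ℝ M₅ g), g 0, g 1, g 2] (by
      refine Polynomial.funext fun t => ?_
      simp only [Fin.sum_univ_four, Matrix.cons_val, eval_add, eval_smul, hw, hy, smul_eq_mul,
        eval_zero, E3.inner_eq]
      linear_combination k * ((t - a_r) ^ 2 + a_c ^ 2) * gV + k * (t - a₄) * gA
        + k * (t - a₄) * (t - a_r) * gB)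
    exact E3.ext (this 1) (this 2) (this 3)
  refine ⟨V, A, B, 1, fun i => 1 / (L.coord i - a₄), hac, ?_, ?_, ?_, ?_, ?_, hnorm, ?_, ?_, ?_⟩
  · intro h0
    obtain ⟨g, hg0, h1, h2⟩ := exists_ne_zero_orthogonal A B
    exact hg0 (hdep g (by simp [h0]) h1 h2)
  · intro h0
    have hA0 : A = 0 := by simpa [h0] using hnorm
    obtain ⟨g, hg0, h1, -⟩ := exists_ne_zero_orthogonal V V
    exact hg0 (hdep g h1 (by simp [hA0]) (by simp [h0]))
  · simp only [E3.inner_eq, hV, hA]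
    field_simp
    linear_combination (a_r - a₄) * hPv1 + a_c * hPv2
  · simp only [E3.inner_eq, hV, hB]
    field_simp
    linear_combination (a_r - a₄) * hPv2 - a_c * hPv1
  · simp only [E3.inner_eq, hA, hB]
    field_simp
    linear_combination ((a_r - a₄) ^ 2 - a_c ^ 2) * hPQ2 - (a_r - a₄) * a_c * hPQ1
  all_goals
    have hne : ∀ i, L.coord i - a₄ ≠ 0 := fun i h0 => (hleg i).1 (by rw [hw, h0]; ring)
  · intro i
    simp [hne i]
  · intro i
    have h1 := hne i
    have h2 := hD (L.coord i)
    rw [(hleg i).2]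
    ext j
    simp only [ratPoint, hw, hy, PiLp.add_apply, PiLp.smul_apply, smul_eq_mul]
    field_simp
    ring
  · refine rowsNondegenerate_of_injective (a₄ := a₄) hac (fun i j hij => L.distinct ?_)
      fun i => by simp [hne i]
    simp only [(hleg i).2, (hleg j).2, hij]

theorem IsType2.hasNormalForm {L : LinearPentapod} {a₄ a_r a_c : ℝ} {M₅ : E3}
    (h : L.IsType2 a₄ a_r a_c M₅) :
    ∃ V A B ε c, L.HasNormalForm a₄ a_r a_c M₅ V A B ε c := by
  obtain ⟨w, y, ν, hwd, hyd, hac, hwc, hyc, hiso, hν, hperp, hw2, hM, hleg, hs⟩ := h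
  have hD : ∀ r : ℝ, (r - a_r) ^ 2 + a_c ^ 2 ≠ 0 := fun r => by positivity
  set k := w.coeff 2 with hk
  have hform : ∀ q : ℝ[X], q.natDegree ≤ 2 → ∀ t, q.eval t
      = q.coeff 2 * ((t - a_r) ^ 2 + a_c ^ 2) + (cval q a_r a_c).re
        + (t - a_r) * ((cval q a_r a_c).im / a_c) := fun q hq t => by
    have h3 : q.coeff 3 = 0 := coeff_eq_zero_of_natDegree_lt (by omega)
    rw [eval_of_natDegree_le_three (by omega), cval_of_natDegree_le_three (by omega), h3]
    field_simp
    ring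
  have hw : ∀ t, w.eval t = k * ((t - a_r) ^ 2 + a_c ^ 2) := fun t => by
    simp [hform w hwd, hwc, hk]
  set P : Fin 3 → ℝ := fun j => (cval (y j) a_r a_c).re with hPdef
  set Q : Fin 3 → ℝ := fun j => (cval (y j) a_r a_c).im with hQdef
  have hPQ : (P 0 ^ 2 + P 1 ^ 2 + P 2 ^ 2 = Q 0 ^ 2 + Q 1 ^ 2 + Q 2 ^ 2) ∧
      P 0 * Q 0 + P 1 * Q 1 + P 2 * Q 2 = 0 := by
    have h1 := congrArg Complex.re hiso
    have h2 := congrArg Complex.im hiso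
    simp [Fin.sum_univ_three, pow_two] at h1 h2
    simp only [hPdef, hQdef]
    constructor <;> linarith
  have hPν : (P 0 * ν 0 + P 1 * ν 1 + P 2 * ν 2 = 0) ∧ Q 0 * ν 0 + Q 1 * ν 1 + Q 2 * ν 2 = 0 := by
    have h1 := congrArg Complex.re hperp
    have h2 := congrArg Complex.im hperp
    simp [Fin.sum_univ_three] at h1 h2
    exact ⟨h1, h2⟩
  obtain ⟨hPQ1, hPQ2⟩ := hPQ
  obtain ⟨hPν1, hPν2⟩ := hPν
  set A : E3 := WithLp.toLp 2 fun j => P j / k with hA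
  set B : E3 := WithLp.toLp 2 fun j => Q j / a_c / k with hB
  have hpt : ∀ t, ratPoint w y t = M₅ + (1 / ((t - a_r) ^ 2 + a_c ^ 2)) • A
      + ((t - a_r) / ((t - a_r) ^ 2 + a_c ^ 2)) • B := fun t => by
    ext j
    have h1 := hD t
    simp only [ratPoint, hw, hform _ (hyd j), PiLp.add_apply, PiLp.smul_apply, smul_eq_mul, hM, hA,
      hB, hPdef, hQdef]
    field_simp
  have hc : ∀ i, ∃ c : ℝ, c * (L.coord i - a₄) = 0 ∧ L.base i = ratPoint w y (L.coord i) + c • ν := by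
    intro i
    rcases hleg i with ⟨-, hb⟩ | ⟨ht, c, hb⟩
    · exact ⟨0, by simp, by simpa using hb⟩
    · exact ⟨c, by simp [ht], by rw [ht, hb]⟩
  choose c hc0 hcb using hc
  have hbase : ∀ i, L.base i = M₅ + (1 / ((L.coord i - a_r) ^ 2 + a_c ^ 2)) • A
      + ((L.coord i - a_r) / ((L.coord i - a_r) ^ 2 + a_c ^ 2)) • B + c i • ν := fun i => by
    rw [hcb, hpt]
  have hnorm : ‖A‖ ^ 2 = a_c ^ 2 * ‖B‖ ^ 2 := by
    simp only [E3.norm_sq_eq, hA, hB]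
    field_simp
    exact hPQ1
  refine ⟨ν, A, B, 0, c, hac, hν, ?_, ?_, ?_, ?_, hnorm, hc0, hbase,
    rowsNondegenerate_of_not_singular hac hc0 hbase hs⟩
  · intro h0
    have hA0 : A = 0 := by simpa [h0] using hnorm
    obtain ⟨j, hj⟩ := hyc
    apply hj
    have h1 : A j = 0 := by rw [hA0]; rfl
    have h2 : B j = 0 := by rw [h0]; rfl
    simp only [hA, hB] at h1 h2
    apply Complex.ext
    · simpa [hw2, hPdef] using h1
    · simpa [hw2, hac, hQdef] using h2
  · simp only [E3.inner_eq, hA]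
    field_simp
    linear_combination hPν1
  · simp only [E3.inner_eq, hB]
    field_simp
    linear_combination hPν2
  · simp only [E3.inner_eq, hA, hB]
    field_simp
    linear_combination hPQ2

end LinearPentapod

/-! ### Curves on the unit sphere -/

/-- A continuous function on a connected set that satisfies a quartic equation is constant. -/
lemma eq_of_quartic {I : Set ℝ} {y : ℝ → ℝ} (hI : IsPreconnected I) (hy : ContinuousOn y I)
    {a b c d k : ℝ} (ha : a ≠ 0)
    (h : ∀ s ∈ I, a * y s ^ 4 + b * y s ^ 3 + c * y s ^ 2 + d * y s + k = 0) :
    ∀ s ∈ I, ∀ r ∈ I, y s = y r := by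
  set p : ℝ[X] := C a * X ^ 4 + C b * X ^ 3 + C c * X ^ 2 + C d * X + C k with hp
  have hp0 : p ≠ 0 := by
    intro h0
    have h1 : p.coeff 4 = a := by
      simp [hp, coeff_X_pow]
    rw [h0, coeff_zero] at h1
    exact ha h1.symm
  have hsub : y '' I ⊆ p.rootSet ℝ := by
    rintro _ ⟨s, hs, rfl⟩
    rw [mem_rootSet]
    exact ⟨hp0, by simpa [hp] using h s hs⟩
  have hfin : (y '' I).Finite := (p.rootSet_finite ℝ).subset hsub
  have hss : (y '' I).Subsingleton :=
    hfin.countable.isTotallyDisconnected _ subset_rfl (hI.image y hy)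
  exact fun s hs r hr => hss (Set.mem_image_of_mem y hs) (Set.mem_image_of_mem y hr)

/-- A curve on the unit sphere that is contained in two intersecting planes is constant. -/
lemma eq_of_inner_const {I : Set ℝ} {u : ℝ → E3} (hI : IsPreconnected I) (hu : ContinuousOn u I)
    (hn : ∀ s ∈ I, ‖u s‖ = 1) {m v : E3} (hmv : cross m v ≠ 0) {h k : ℝ}
    (hm : ∀ s ∈ I, inner ℝ m (u s) = h) (hv : ∀ s ∈ I, inner ℝ v (u s) = k) :
    ∀ s ∈ I, ∀ r ∈ I, u s = u r := by
  set q := cross m v with hq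
  have hqc : ∀ s ∈ I, ∀ r ∈ I, inner ℝ q (u s) = inner ℝ q (u r) := by
    -- the squared equation has degree two, so it is squared once more
    have hcont : ContinuousOn (fun s => inner ℝ q (u s)) I := by fun_prop
    set K := ‖m‖ ^ 2 * ‖v‖ ^ 2 + 2 * inner ℝ m v * k * h - ‖m‖ ^ 2 * k ^ 2 - ‖v‖ ^ 2 * h ^ 2
      - inner ℝ m v ^ 2 with hK
    refine eq_of_quartic hI hcont (a := 1) (b := 0) (c := 0) (d := 0) (k := -K ^ 2) one_ne_zero ?_
    intro s hs
    have h1 := inner_cross_sq m v (u s)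
    rw [hm s hs, hv s hs, hn s hs] at h1
    have h2 : inner ℝ q (u s) ^ 2 = K := by rw [hq, h1, hK]; ring
    linear_combination (inner ℝ q (u s) ^ 2 + K) * h2
  intro s hs r hr
  refine ext_inner_left ℝ fun l => ?_
  have h1 := norm_cross_sq_mul_inner m v l (u s)
  have h2 := norm_cross_sq_mul_inner m v l (u r)
  rw [hm s hs, hv s hs, ← hq, hqc s hs r hr] at h1
  rw [hm r hr, hv r hr, ← hq, ← h1] at h2
  have h3 : ‖q‖ ^ 2 ≠ 0 := by positivity
  exact (mul_left_cancel₀ h3 h2).symm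

/-- On a planar curve of the unit sphere that lies on the quadric `α (v · u)² + l · u = k`, the
function `v · u` is constant: elimination of the third coordinate gives a quartic equation for it,
with leading coefficient proportional to `α²`. -/
lemma inner_const_of_planar {I : Set ℝ} {u : ℝ → E3} (hI : IsPreconnected I)
    (hu : ContinuousOn u I) (hn : ∀ s ∈ I, ‖u s‖ = 1) {m v l : E3} (hm0 : m ≠ 0) (hv0 : v ≠ 0)
    {h k α : ℝ} (hα : α ≠ 0) (hm : ∀ s ∈ I, inner ℝ m (u s) = h)
    (hq : ∀ s ∈ I, α * inner ℝ v (u s) ^ 2 + inner ℝ l (u s) = k) :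
    ∀ s ∈ I, ∀ r ∈ I, inner ℝ v (u s) = inner ℝ v (u r) := by
  by_cases hc : cross m v = 0
  · have h1 := norm_sq_smul_eq_of_cross_eq_zero hc
    have h2 : inner ℝ m v ≠ 0 := by
      intro h0
      rw [h0, zero_smul] at h1
      have : ‖v‖ ^ 2 ≠ 0 := by positivity
      exact smul_ne_zero this hm0 h1
    have h3 : ∀ s ∈ I, inner ℝ v (u s) = ‖v‖ ^ 2 * h / inner ℝ m v := fun s hs => by
      have := congrArg (fun z => inner ℝ z (u s)) h1
      simp only [real_inner_smul_left, hm s hs] at this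
      field_simp
      linear_combination -this
    exact fun s hs r hr => (h3 s hs).trans (h3 r hr).symm
  · have hcont : ContinuousOn (fun s => inner ℝ v (u s)) I := by fun_prop
    set q := cross m v with hqd
    set c0 := inner ℝ l q
    set c1 := inner ℝ l m * ‖v‖ ^ 2 - inner ℝ l v * inner ℝ m v
    set c2 := inner ℝ l v * ‖m‖ ^ 2 - inner ℝ l m * inner ℝ m v
    set e := ‖q‖ ^ 2 * k - c1 * h
    have hlead : (‖q‖ ^ 2 * α) ^ 2 ≠ 0 := by positivity
    refine eq_of_quartic hI hcont hlead (b := 2 * (‖q‖ ^ 2 * α) * c2)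
      (c := c2 ^ 2 - 2 * (‖q‖ ^ 2 * α) * e + c0 ^ 2 * ‖m‖ ^ 2)
      (d := -2 * e * c2 - c0 ^ 2 * (2 * inner ℝ m v * h))
      (k := e ^ 2 - c0 ^ 2 * (‖m‖ ^ 2 * ‖v‖ ^ 2 - ‖v‖ ^ 2 * h ^ 2 - inner ℝ m v ^ 2)) ?_
    intro s hs
    have h1 := inner_cross_sq m v (u s)
    have h2 := norm_cross_sq_mul_inner m v l (u s)
    have h3 := hq s hs
    rw [← hqd] at h1 h2
    rw [hm s hs, hn s hs] at h1
    rw [hm s hs] at h2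
    set y := inner ℝ v (u s)
    set z := inner ℝ q (u s)
    have h4 : c0 * z = e - c2 * y - ‖q‖ ^ 2 * α * y ^ 2 := by
      linear_combination -h2 + ‖q‖ ^ 2 * h3
    linear_combination c0 ^ 2 * h1
      - (c0 * z + (e - c2 * y - ‖q‖ ^ 2 * α * y ^ 2)) * h4

/-! ### The affine relation between the direction and the position of the line -/

/-- The linear map `d ↦ a d + p (V · d) V + k ((A · d) B - (B · d) A)`. -/
noncomputable def pencilMap (a p k : ℝ) (V A B d : E3) : E3 :=
  a • d + (p * inner ℝ V d) • V + k • (inner ℝ A d • B - inner ℝ B d • A)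

/-- The adjoint of `pencilMap` is obtained by changing the sign of the skew part. -/
lemma inner_pencilMap (a p k : ℝ) (V A B d u : E3) :
    inner ℝ d (pencilMap a p k V A B u) = inner ℝ (pencilMap a p (-k) V A B d) u := by
  simp only [pencilMap, inner_add_left, inner_add_right, inner_sub_left, inner_sub_right,
    real_inner_smul_left, real_inner_smul_right, real_inner_comm d]
  ring

lemma inner_self_pencilMap (a p k : ℝ) (V A B d : E3) :
    inner ℝ d (pencilMap a p k V A B d) = a * ‖d‖ ^ 2 + p * inner ℝ V d ^ 2 := by
  simp only [pencilMap, inner_add_right, inner_sub_right, real_inner_smul_right,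
    real_inner_self_eq_norm_sq, real_inner_comm d]
  ring

/-- If the position is `C` minus `pencilMap` of the unit direction `u`, then a fixed inner product of
position and direction confines `u` to a quadric. -/
lemma direction_quadric {a p k q : ℝ} {V A B C x u : E3} (hx : x = C - pencilMap a p k V A B u)
    (hu : ‖u‖ = 1) (hxu : inner ℝ x u = -q) :
    p * inner ℝ V u ^ 2 - inner ℝ C u = q - a := by
  rw [hx, real_inner_comm, inner_sub_right, inner_self_pencilMap, hu] at hxu
  rw [real_inner_comm u C]
  linear_combination -hxu

namespace LinearPentapod

namespace HasNormalForm

variable {L : LinearPentapod} {a₄ a_r a_c : ℝ} {M₅ V A B : E3} {ε : ℝ} {c : Fin 5 → ℝ}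

lemma A_ne (h : L.HasNormalForm a₄ a_r a_c M₅ V A B ε c) : A ≠ 0 := by
  rintro rfl
  have h1 := h.norm_A
  have h2 := h.a_c_ne
  have h3 := h.B_ne
  have : a_c ^ 2 * ‖B‖ ^ 2 ≠ 0 := by positivity
  exact this (by simpa using h1.symm)

lemma eq_zero (h : L.HasNormalForm a₄ a_r a_c M₅ V A B ε c) {w : E3} (wV : inner ℝ V w = 0)
    (wA : inner ℝ A w = 0) (wB : inner ℝ B w = 0) : w = 0 :=
  eq_zero_of_inner_orthogonal h.V_ne h.A_ne h.B_ne h.inner_V_A h.inner_V_B h.inner_A_B wV wA wB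

lemma inner_V_pencilMap (h : L.HasNormalForm a₄ a_r a_c M₅ V A B ε c) (w : E3) :
    inner ℝ V (pencilMap a_r ((a₄ - a_r) / ‖V‖ ^ 2) (1 / ‖B‖ ^ 2) V A B w) = a₄ * inner ℝ V w := by
  have hV2 : ‖V‖ ≠ 0 := by simpa using h.V_ne
  simp only [pencilMap, inner_add_right, inner_sub_right, real_inner_smul_right,
    h.inner_V_A, h.inner_V_B, real_inner_self_eq_norm_sq]
  field_simp
  ring

/-- The leg equation for the platform coordinate `t` is linear in the row
`(1, t, 1/D, (t - a_r)/D, c)`. -/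
lemma leg_expansion {x u : E3} {t a : ℝ} (hac : a_c ≠ 0) (hu : ‖u‖ = 1) (ha : a * (t - a₄) = ε) :
    ‖x + t • u - ((1 / ((t - a_r) ^ 2 + a_c ^ 2)) • A
      + ((t - a_r) / ((t - a_r) ^ 2 + a_c ^ 2)) • B + a • V)‖ ^ 2
    = (‖x‖ ^ 2 - 2 * (ε * inner ℝ V u + inner ℝ B u)) + 2 * inner ℝ x u * t
      + -2 * (inner ℝ A x + a_r * inner ℝ A u - a_c ^ 2 * inner ℝ B u)
        * (1 / ((t - a_r) ^ 2 + a_c ^ 2))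
      + -2 * (inner ℝ B x + a_r * inner ℝ B u + inner ℝ A u)
        * ((t - a_r) / ((t - a_r) ^ 2 + a_c ^ 2))
      + -2 * (inner ℝ V x + a₄ * inner ℝ V u) * a
      + (t ^ 2 + ‖(1 / ((t - a_r) ^ 2 + a_c ^ 2)) • A
      + ((t - a_r) / ((t - a_r) ^ 2 + a_c ^ 2)) • B + a • V‖ ^ 2) := by
  have hD : (t - a_r) ^ 2 + a_c ^ 2 ≠ 0 := by positivity
  rw [norm_sub_sq_real, norm_add_sq_real, norm_smul, hu, Real.norm_eq_abs, mul_pow, sq_abs,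
    ← ha]
  generalize ‖(1 / ((t - a_r) ^ 2 + a_c ^ 2)) • A
      + ((t - a_r) / ((t - a_r) ^ 2 + a_c ^ 2)) • B + a • V‖ = n
  simp only [inner_add_left, inner_add_right, real_inner_smul_left, real_inner_smul_right,
    real_inner_comm A x, real_inner_comm B x, real_inner_comm V x, real_inner_comm A u,
    real_inner_comm B u, real_inner_comm V u]
  field_simp
  ring

/-- During a self-motion the position of `p` is an affine function of its direction, and two
quadratic functions of position and direction are constant. -/
theorem exists_constants (h : L.HasNormalForm a₄ a_r a_c M₅ V A B ε c) {I : Set ℝ}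
    {x u : ℝ → E3} (hu : ∀ s ∈ I, ‖u s‖ = 1)
    (hleg : ∀ s ∈ I, ∀ i, ‖M₅ + x s + L.coord i • u s - L.base i‖ = L.len i) :
    ∃ (C : E3) (p₅ k : ℝ), ∀ s ∈ I,
      x s = C - pencilMap a_r ((a₄ - a_r) / ‖V‖ ^ 2) (1 / ‖B‖ ^ 2) V A B (u s) ∧
      inner ℝ (x s) (u s) = -p₅ ∧ ‖x s‖ ^ 2 - 2 * (ε * inner ℝ V (u s) + inner ℝ B (u s)) = k := by
  rcases I.eq_empty_or_nonempty with rfl | ⟨s₀, hs₀⟩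
  · exact ⟨0, 0, 0, by simp⟩
  set Y : ℝ → Fin 5 → ℝ := fun s => ![‖x s‖ ^ 2 - 2 * (ε * inner ℝ V (u s) + inner ℝ B (u s)),
    2 * inner ℝ (x s) (u s),
    -2 * (inner ℝ A (x s) + a_r * inner ℝ A (u s) - a_c ^ 2 * inner ℝ B (u s)),
    -2 * (inner ℝ B (x s) + a_r * inner ℝ B (u s) + inner ℝ A (u s)),
    -2 * (inner ℝ V (x s) + a₄ * inner ℝ V (u s))] with hY
  have hconst : ∀ s ∈ I, Y s - Y s₀ = 0 := by
    intro s hs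
    refine h.rows _ fun i => ?_
    have key := fun r (hr : r ∈ I) =>
      leg_expansion (ε := ε) (a₄ := a₄) (a_r := a_r) (V := V) (A := A) (B := B) (x := x r)
        h.a_c_ne (hu r hr) (h.c_mul i)
    have hl : ∀ r ∈ I, ‖x r + L.coord i • u r - ((1 / ((L.coord i - a_r) ^ 2 + a_c ^ 2)) • A
        + ((L.coord i - a_r) / ((L.coord i - a_r) ^ 2 + a_c ^ 2)) • B + c i • V)‖ = L.len i := fun r hr => by
      have h1 := hleg r hr i
      rwa [h.base_eq i, show ∀ a b d e g : E3, M₅ + a + b - (M₅ + d + e + g) = a + b - (d + e + g)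
        from fun a b d e g => by abel] at h1
    have h1 := key s hs
    have h2 := key s₀ hs₀
    rw [hl s hs] at h1
    rw [hl s₀ hs₀] at h2
    simp only [hY, Pi.sub_apply, Matrix.cons_val]
    linear_combination h2 - h1
  set T := pencilMap a_r ((a₄ - a_r) / ‖V‖ ^ 2) (1 / ‖B‖ ^ 2) V A B with hT
  have hB2 : ‖B‖ ≠ 0 := by simpa using h.B_ne
  have hTV : ∀ w, inner ℝ V (T w) = a₄ * inner ℝ V w := h.inner_V_pencilMap
  have hTA : ∀ w, inner ℝ A (T w) = a_r * inner ℝ A w - a_c ^ 2 * inner ℝ B w := fun w => by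
    simp only [hT, pencilMap, inner_add_right, inner_sub_right, real_inner_smul_right,
      real_inner_comm V A, h.inner_V_A, h.inner_A_B, real_inner_self_eq_norm_sq, h.norm_A]
    field_simp
    ring
  have hTB : ∀ w, inner ℝ B (T w) = a_r * inner ℝ B w + inner ℝ A w := fun w => by
    simp only [hT, pencilMap, inner_add_right, inner_sub_right, real_inner_smul_right,
      real_inner_comm V B, real_inner_comm A B, h.inner_V_B, h.inner_A_B,
      real_inner_self_eq_norm_sq]
    field_simp
    ring
  refine ⟨x s₀ + T (u s₀), -inner ℝ (x s₀) (u s₀),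
    ‖x s₀‖ ^ 2 - 2 * (ε * inner ℝ V (u s₀) + inner ℝ B (u s₀)), fun s hs => ?_⟩
  have hc := hconst s hs
  have e0 := congrFun hc 0
  have e1 := congrFun hc 1
  have e2 := congrFun hc 2
  have e3 := congrFun hc 3
  have e4 := congrFun hc 4
  simp only [hY, Pi.sub_apply, Matrix.cons_val, Pi.zero_apply] at e0 e1 e2 e3 e4
  refine ⟨?_, by linarith, by linarith⟩
  rw [← sub_eq_zero]
  apply h.eq_zero <;> simp only [inner_sub_right, inner_add_right, hTV, hTA, hTB] <;> linarith

/-- The expansion of `‖d‖²` in the orthogonal frame `V, A, B`. -/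
lemma norm_sq_expansion (h : L.HasNormalForm a₄ a_r a_c M₅ V A B ε c) (d : E3) :
    ‖d‖ ^ 2 = inner ℝ V d ^ 2 / ‖V‖ ^ 2 + inner ℝ A d ^ 2 / ‖A‖ ^ 2
      + inner ℝ B d ^ 2 / ‖B‖ ^ 2 := by
  have hV2 : ‖V‖ ≠ 0 := by simpa using h.V_ne
  have hB2 : ‖B‖ ≠ 0 := by simpa using h.B_ne
  have hA2 : ‖A‖ ≠ 0 := by simpa using h.A_ne
  have hd : d - ((inner ℝ V d / ‖V‖ ^ 2) • V + (inner ℝ A d / ‖A‖ ^ 2) • A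
      + (inner ℝ B d / ‖B‖ ^ 2) • B) = 0 := by
    apply h.eq_zero <;>
    simp only [inner_add_right, inner_sub_right, real_inner_smul_right, h.inner_V_A, h.inner_V_B,
      h.inner_A_B, real_inner_comm V A, real_inner_comm V B, real_inner_comm A B,
      real_inner_self_eq_norm_sq] <;> field_simp <;> ring
  have h2 := congrArg (fun z => inner ℝ z d) (sub_eq_zero.1 hd)
  simp only [inner_add_left, real_inner_smul_left, real_inner_self_eq_norm_sq] at h2
  rw [h2]
  ring

lemma norm_pencilMap_sq (h : L.HasNormalForm a₄ a_r a_c M₅ V A B ε c) (d : E3) :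
    ‖pencilMap a_r ((a₄ - a_r) / ‖V‖ ^ 2) (1 / ‖B‖ ^ 2) V A B d‖ ^ 2
      = (a_r ^ 2 + a_c ^ 2) * ‖d‖ ^ 2
        + (a₄ ^ 2 - a_r ^ 2 - a_c ^ 2) / ‖V‖ ^ 2 * inner ℝ V d ^ 2 := by
  have hV2 : ‖V‖ ≠ 0 := by simpa using h.V_ne
  have hB2 : ‖B‖ ≠ 0 := by simpa using h.B_ne
  have hac := h.a_c_ne
  have he := h.norm_sq_expansion d
  rw [← real_inner_self_eq_norm_sq]
  nth_rewrite 1 [pencilMap]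
  simp only [inner_add_left, inner_sub_left, real_inner_smul_left, h.inner_V_pencilMap,
    inner_self_pencilMap]
  simp only [pencilMap, inner_add_right, inner_sub_right, real_inner_smul_right, h.inner_V_A,
    h.inner_V_B, h.inner_A_B, real_inner_comm V A, real_inner_comm V B, real_inner_comm A B,
    real_inner_self_eq_norm_sq]
  rw [h.norm_A] at he ⊢
  rw [he]
  field_simp
  ring

/-- The direction of `p` does not stay in a plane during a self-motion. -/
theorem not_planar (h : L.HasNormalForm a₄ a_r a_c M₅ V A B ε c) {I : Set ℝ}
    {x u : ℝ → E3} {C : E3} {p₅ k : ℝ} (hI : IsPreconnected I) (hu : ContinuousOn u I)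
    (hn : ∀ s ∈ I, ‖u s‖ = 1) (hmove : ∃ s ∈ I, ∃ r ∈ I, u s ≠ u r)
    (hconst : ∀ s ∈ I,
      x s = C - pencilMap a_r ((a₄ - a_r) / ‖V‖ ^ 2) (1 / ‖B‖ ^ 2) V A B (u s) ∧
      inner ℝ (x s) (u s) = -p₅ ∧ ‖x s‖ ^ 2 - 2 * (ε * inner ℝ V (u s) + inner ℝ B (u s)) = k)
    {m : E3} {q : ℝ} (hm : ∀ s ∈ I, inner ℝ m (u s) = q) : m = 0 := by
  by_contra hm0
  obtain ⟨s₀, hs₀, r₀, hr₀, hne⟩ := hmove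
  have hV2 : ‖V‖ ≠ 0 := by simpa using h.V_ne
  have H1 : ∀ s ∈ I, (a_r - a₄) / ‖V‖ ^ 2 * inner ℝ V (u s) ^ 2 + inner ℝ C (u s) = a_r - p₅ := by
    intro s hs
    obtain ⟨e1, e2, -⟩ := hconst s hs
    linear_combination -direction_quadric e1 (hn s hs) e2
  have H2 : ∀ s ∈ I, (a₄ ^ 2 - a_r ^ 2 - a_c ^ 2) / ‖V‖ ^ 2 * inner ℝ V (u s) ^ 2
      - 2 * inner ℝ C (pencilMap a_r ((a₄ - a_r) / ‖V‖ ^ 2) (1 / ‖B‖ ^ 2) V A B (u s))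
      - 2 * (ε * inner ℝ V (u s) + inner ℝ B (u s)) = k - ‖C‖ ^ 2 - a_r ^ 2 - a_c ^ 2 := by
    intro s hs
    obtain ⟨e1, -, e3⟩ := hconst s hs
    rw [e1, norm_sub_sq_real, h.norm_pencilMap_sq, hn s hs] at e3
    linear_combination e3
  have hVu : ∀ s ∈ I, inner ℝ V (u s) = inner ℝ V (u s₀) := by
    intro s hs
    by_cases ha : a_r = a₄
    · refine inner_const_of_planar hI hu hn hm0 h.V_ne (l := (-2 : ℝ) •
        (pencilMap a_r ((a₄ - a_r) / ‖V‖ ^ 2) (-(1 / ‖B‖ ^ 2)) V A B C + ε • V + B))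
        (α := (a₄ ^ 2 - a_r ^ 2 - a_c ^ 2) / ‖V‖ ^ 2) (k := k - ‖C‖ ^ 2 - a_r ^ 2 - a_c ^ 2) ?_ hm (fun s hs => ?_) s hs s₀ hs₀
      · have := h.a_c_ne
        refine div_ne_zero ?_ (by positivity)
        rw [ha, sub_self, zero_sub]
        exact neg_ne_zero.2 (by positivity)
      · rw [real_inner_smul_left, inner_add_left, inner_add_left, ← inner_pencilMap,
          real_inner_smul_left, ← H2 s hs]
        ring
    · exact inner_const_of_planar hI hu hn hm0 h.V_ne
        (div_ne_zero (sub_ne_zero.2 ha) (by positivity)) hm H1 s hs s₀ hs₀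
  have hCu : ∀ s ∈ I, inner ℝ C (u s) = inner ℝ C (u s₀) := by
    intro s hs
    have h1 := H1 s hs
    rw [hVu s hs] at h1
    linear_combination h1 - H1 s₀ hs₀
  have hCV : cross C V = 0 := by
    by_contra hc
    exact hne (eq_of_inner_const hI hu hn hc hCu hVu s₀ hs₀ r₀ hr₀)
  have hCe : ∀ w, inner ℝ C w = inner ℝ C V / ‖V‖ ^ 2 * inner ℝ V w := fun w => by
    have := congrArg (fun z => inner ℝ z w) (norm_sq_smul_eq_of_cross_eq_zero hCV)
    simp only [real_inner_smul_left] at this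
    field_simp
    linear_combination this
  have hBu : ∀ s ∈ I, inner ℝ B (u s) = inner ℝ B (u s₀) := by
    intro s hs
    have h1 := H2 s hs
    have h2 := H2 s₀ hs₀
    rw [hCe, h.inner_V_pencilMap] at h1 h2
    rw [hVu s hs] at h1
    linear_combination (h2 - h1) / 2
  have hVB : cross V B ≠ 0 := by
    intro h0
    have h1 := norm_cross_sq V B
    have h2 := h.V_ne
    have h3 := h.B_ne
    have : ‖V‖ ^ 2 * ‖B‖ ^ 2 ≠ 0 := by positivity
    rw [h0, h.inner_V_B, norm_zero] at h1
    exact this (by linear_combination -h1)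
  exact hne (eq_of_inner_const hI hu hn hVB hVu hBu s₀ hs₀ r₀ hr₀)

end HasNormalForm
end LinearPentapod

/-! ### Hausdorff dimension of spherical curves -/

lemma expansion_of_orthonormal {e₁ e₂ e₃ : E3} (h1 : ‖e₁‖ = 1) (h2 : ‖e₂‖ = 1) (h3 : ‖e₃‖ = 1)
    (h12 : inner ℝ e₁ e₂ = 0) (h13 : inner ℝ e₁ e₃ = 0) (h23 : inner ℝ e₂ e₃ = 0) (d : E3) :
    d = inner ℝ e₁ d • e₁ + inner ℝ e₂ d • e₂ + inner ℝ e₃ d • e₃ := by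
  have ne : ∀ {e : E3}, ‖e‖ = 1 → e ≠ 0 := fun h h0 => by simp [h0] at h
  rw [← sub_eq_zero]
  apply eq_zero_of_inner_orthogonal (ne h1) (ne h2) (ne h3) h12 h13 h23 <;>
  simp [inner_sub_right, inner_add_right, real_inner_smul_right, h12, h13, h23, h1, h2, h3,
    real_inner_comm e₁ e₂, real_inner_comm e₁ e₃, real_inner_comm e₂ e₃]

lemma norm_sq_of_orthonormal {e₁ e₂ e₃ : E3} (h1 : ‖e₁‖ = 1) (h2 : ‖e₂‖ = 1) (h3 : ‖e₃‖ = 1)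
    (h12 : inner ℝ e₁ e₂ = 0) (h13 : inner ℝ e₁ e₃ = 0) (h23 : inner ℝ e₂ e₃ = 0) (d : E3) :
    ‖d‖ ^ 2 = inner ℝ e₁ d ^ 2 + inner ℝ e₂ d ^ 2 + inner ℝ e₃ d ^ 2 := by
  have := congrArg (fun z => inner ℝ z d) (expansion_of_orthonormal h1 h2 h3 h12 h13 h23 d)
  simp only [inner_add_left, real_inner_smul_left, real_inner_self_eq_norm_sq] at this
  rw [this]; ring

lemma exists_orthonormal_frame {V : E3} (hV : V ≠ 0) (C : E3) : ∃ e₁ e₂ e₃ : E3,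
    ‖e₁‖ = 1 ∧ ‖e₂‖ = 1 ∧ ‖e₃‖ = 1 ∧ inner ℝ e₁ e₂ = 0 ∧ inner ℝ e₁ e₃ = 0 ∧ inner ℝ e₂ e₃ = 0 ∧
    V = ‖V‖ • e₁ ∧ inner ℝ C e₃ = 0 := by
  obtain ⟨g, hg0, hVg, hCg⟩ := exists_ne_zero_orthogonal V C
  have hVn : ‖V‖ ≠ 0 := by simpa
  have hgn : ‖g‖ ≠ 0 := by simpa
  have h1 : ‖(‖V‖⁻¹ • V : E3)‖ = 1 := by rw [norm_smul]; simp [hVn]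
  have h3 : ‖(‖g‖⁻¹ • g : E3)‖ = 1 := by rw [norm_smul]; simp [hgn]
  have h13 : inner ℝ (‖V‖⁻¹ • V) (‖g‖⁻¹ • g) = 0 := by
    rw [real_inner_smul_left, real_inner_smul_right, hVg]; simp
  refine ⟨‖V‖⁻¹ • V, cross (‖g‖⁻¹ • g) (‖V‖⁻¹ • V), ‖g‖⁻¹ • g, h1, ?_, h3, ?_, h13, ?_, ?_, ?_⟩
  · rw [← sq_eq_sq₀ (norm_nonneg _) zero_le_one, norm_cross_sq, h1, h3, real_inner_comm, h13]
    norm_num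
  · generalize ‖V‖⁻¹ • V = a
    generalize ‖g‖⁻¹ • g = b
    simp only [E3.inner_eq, cross_apply_zero, cross_apply_one, cross_apply_two]
    ring
  · generalize ‖V‖⁻¹ • V = a
    generalize ‖g‖⁻¹ • g = b
    simp only [E3.inner_eq, cross_apply_zero, cross_apply_one, cross_apply_two]
    ring
  · rw [smul_smul, mul_inv_cancel₀ hVn, one_smul]
  · rw [real_inner_smul_right, hCg, mul_zero]

lemma dimH_image_le_one {f : ℝ → E3} {s : Set ℝ} (h : ∀ t ∈ s, ContDiffAt ℝ 1 f t) :
    dimH (f '' s) ≤ 1 := by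
  refine (dimH_image_le_of_locally_lipschitzOn fun t ht => ?_).trans
    ((dimH_mono (Set.subset_univ s)).trans Real.dimH_univ.le)
  obtain ⟨K, U, hU, hK⟩ := (h t ht).exists_lipschitzOnWith
  exact ⟨K, U, mem_nhdsWithin_of_mem_nhds hU, hK⟩

lemma exists_polar {x y r : ℝ} (hr : 0 ≤ r) (h : x ^ 2 + y ^ 2 = r ^ 2) :
    ∃ θ : ℝ, x = r * Real.cos θ ∧ y = r * Real.sin θ := by
  have hn : ‖(⟨x, y⟩ : ℂ)‖ = r := by
    rw [← sq_eq_sq₀ (norm_nonneg _) hr, ← h, ← Complex.normSq_eq_norm_sq, Complex.normSq_apply]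
    ring
  refine ⟨Complex.arg ⟨x, y⟩, ?_, ?_⟩
  · rw [← hn, Complex.norm_mul_cos_arg]
  · rw [← hn, Complex.norm_mul_sin_arg]

/-- The intersection of the unit sphere with the parabolic cylinder `p (V · d)² + C · d = k` has
dimension at most one. In a frame whose first vector is parallel to `V` and whose third is
orthogonal to `C`, either the second coordinate is a polynomial in the first one, and the third is
the square root of a polynomial, or the first coordinate takes finitely many values and the set is
a union of circles. -/
theorem dimH_sphere_inter_cylinder_le {V C : E3} {p k : ℝ} (hp : p ≠ 0) (hV : V ≠ 0) :
    dimH {d : E3 | ‖d‖ = 1 ∧ p * inner ℝ V d ^ 2 + inner ℝ C d = k} ≤ 1 := by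
  obtain ⟨e₁, e₂, e₃, h1, h2, h3, h12, h13, h23, hVe, hCe⟩ := exists_orthonormal_frame hV C
  have hexp := expansion_of_orthonormal h1 h2 h3 h12 h13 h23
  have hnorm := norm_sq_of_orthonormal h1 h2 h3 h12 h13 h23
  have hVn : ‖V‖ ≠ 0 := by simpa
  set b := p * ‖V‖ ^ 2 with hb
  have hb0 : b ≠ 0 := by positivity
  set c₁ := inner ℝ C e₁
  set c₂ := inner ℝ C e₂
  have heq : ∀ d, p * inner ℝ V d ^ 2 + inner ℝ C d
      = b * inner ℝ e₁ d ^ 2 + c₁ * inner ℝ e₁ d + c₂ * inner ℝ e₂ d := fun d => by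
    have e1 : inner ℝ V d = ‖V‖ * inner ℝ e₁ d := by
      conv_lhs => rw [hVe, real_inner_smul_left]
    have e2 : inner ℝ C d = c₁ * inner ℝ e₁ d + c₂ * inner ℝ e₂ d := by
      conv_lhs => rw [hexp d]
      simp only [inner_add_right, real_inner_smul_right, hCe]
      ring
    rw [e1, e2, hb]; ring
  by_cases hc : c₂ = 0
  · set F : Set ℝ := {y | b * y ^ 2 + c₁ * y - k = 0}
    have hF : F.Finite := by
      set P : ℝ[X] := Polynomial.C b * X ^ 2 + Polynomial.C c₁ * X - Polynomial.C k with hP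
      have hP0 : P ≠ 0 := by
        intro h0
        have : P.coeff 2 = b := by simp [hP]
        rw [h0, coeff_zero] at this
        exact hb0 this.symm
      refine (P.rootSet_finite ℝ).subset fun y hy => ?_
      rw [mem_rootSet]
      have hy' : b * y ^ 2 + c₁ * y - k = 0 := hy
      exact ⟨hP0, by simpa [hP] using hy'⟩
    set f : ℝ → ℝ → E3 := fun y θ => y • e₁ + (√(1 - y ^ 2) * Real.cos θ) • e₂
      + (√(1 - y ^ 2) * Real.sin θ) • e₃ with hf
    have hsub : {d : E3 | ‖d‖ = 1 ∧ p * inner ℝ V d ^ 2 + inner ℝ C d = k}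
        ⊆ ⋃ y ∈ F, f y '' Set.univ := by
      rintro d ⟨hd, hdk⟩
      have hn := hnorm d
      rw [hd] at hn
      rw [heq, hc] at hdk
      obtain ⟨θ, ht1, ht2⟩ := exists_polar (x := inner ℝ e₂ d) (y := inner ℝ e₃ d)
        (r := √(1 - inner ℝ e₁ d ^ 2)) (Real.sqrt_nonneg _) (by
          rw [Real.sq_sqrt (by nlinarith [sq_nonneg (inner ℝ e₂ d), sq_nonneg (inner ℝ e₃ d)])]
          linarith)
      refine Set.mem_biUnion (x := inner ℝ e₁ d) ?_ ⟨θ, trivial, ?_⟩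
      · change _ = _
        linarith
      · conv_rhs => rw [hexp d]
        simp only [hf]
        rw [← ht1, ← ht2]
    refine (dimH_mono hsub).trans ?_
    rw [dimH_bUnion hF.countable]
    refine iSup₂_le fun y _ => dimH_image_le_one fun θ _ => ?_
    simp only [hf]
    have := Real.contDiff_cos (n := 1)
    have := Real.contDiff_sin (n := 1)
    fun_prop
  · set R : ℝ → ℝ := fun y => (k - b * y ^ 2 - c₁ * y) / c₂ with hR
    set S : ℝ → ℝ := fun y => 1 - y ^ 2 - R y ^ 2 with hS
    have hRd : ContDiff ℝ 1 R := by
      rw [hR]; fun_prop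
    have hSd : ContDiff ℝ 1 S := by
      rw [hS]; fun_prop
    set f : ℝ → ℝ → E3 := fun σ y => y • e₁ + R y • e₂ + (σ * √(S y)) • e₃ with hf
    set f₀ : ℝ → E3 := fun y => y • e₁ + R y • e₂ with hf₀
    have hsub : {d : E3 | ‖d‖ = 1 ∧ p * inner ℝ V d ^ 2 + inner ℝ C d = k}
        ⊆ f₀ '' Set.univ ∪ (f 1 '' {y | S y ≠ 0} ∪ f (-1) '' {y | S y ≠ 0}) := by
      rintro d ⟨hd, hdk⟩
      have hn := hnorm d
      rw [hd] at hn
      rw [heq] at hdk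
      set y := inner ℝ e₁ d with hy
      have hz : inner ℝ e₂ d = R y := by
        simp only [hR]
        field_simp
        linarith
      have hw : inner ℝ e₃ d ^ 2 = S y := by
        simp only [hS, ← hz]
        linarith
      by_cases hw0 : inner ℝ e₃ d = 0
      · left
        refine ⟨y, trivial, ?_⟩
        conv_rhs => rw [hexp d, hw0, zero_smul, add_zero, hz]
      · right
        have hS0 : S y ≠ 0 := by
          rw [← hw]
          positivity
        rcases le_total 0 (inner ℝ e₃ d) with hpos | hneg
        · left
          refine ⟨y, hS0, ?_⟩
          conv_rhs => rw [hexp d, hz]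
          simp only [hf]
          rw [← hw, Real.sqrt_sq hpos, one_mul]
        · right
          refine ⟨y, hS0, ?_⟩
          conv_rhs => rw [hexp d, hz]
          simp only [hf]
          rw [← hw, Real.sqrt_sq_eq_abs, abs_of_nonpos hneg]
          congr 2
          ring
    have hfd : ∀ σ, dimH (f σ '' {y | S y ≠ 0}) ≤ 1 := fun σ =>
      dimH_image_le_one fun y hy => by
        have h4 : ContDiffAt ℝ 1 (fun y => √(S y)) y := hSd.contDiffAt.sqrt hy
        have h5 : ContDiffAt ℝ 1 R y := hRd.contDiffAt
        simp only [hf]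
        fun_prop
    refine (dimH_mono hsub).trans ?_
    rw [dimH_union, dimH_union]
    refine max_le (dimH_image_le_one fun y _ => ?_) (max_le (hfd 1) (hfd (-1)))
    simp only [hf₀]
    have h5 : ContDiffAt ℝ 1 R y := hRd.contDiffAt
    fun_prop

/-- A set containing a nonconstant continuous curve has dimension at least one. -/
lemma one_le_dimH {I : Set ℝ} {u : ℝ → E3} (hI : IsPreconnected I) (hu : ContinuousOn u I)
    (hmove : ∃ s ∈ I, ∃ r ∈ I, u s ≠ u r) {Z : Set E3} (hZ : ∀ s ∈ I, u s ∈ Z) : 1 ≤ dimH Z := by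
  obtain ⟨s, hs, r, hr, hne⟩ := hmove
  obtain ⟨l, hl⟩ : ∃ l : E3, inner ℝ l (u s) ≠ inner ℝ l (u r) := by
    by_contra! h
    exact hne (ext_inner_left ℝ h)
  set g : E3 →L[ℝ] ℝ := innerSL ℝ l with hg
  have hconn : (((fun t => g (u t)) '' I)).OrdConnected :=
    (hI.image _ (g.continuous.comp_continuousOn hu)).ordConnected
  have hsub : Set.uIcc (g (u s)) (g (u r)) ⊆ g '' Z := by
    refine (hconn.uIcc_subset ⟨s, hs, rfl⟩ ⟨r, hr, rfl⟩).trans ?_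
    rintro _ ⟨t, ht, rfl⟩
    exact ⟨u t, hZ t ht, rfl⟩
  have hint : (interior (Set.uIcc (g (u s)) (g (u r)))).Nonempty := by
    rw [Set.uIcc, interior_Icc, Set.nonempty_Ioo]
    exact inf_lt_sup.2 hl
  calc (1 : ENNReal) = dimH (Set.uIcc (g (u s)) (g (u r))) := by
        rw [Real.dimH_of_nonempty_interior hint]; simp
    _ ≤ dimH (g '' Z) := dimH_mono hsub
    _ ≤ dimH Z := g.lipschitz.dimH_image_le Z

lemma dimH_unitSphere : dimH {d : E3 | ‖d‖ = 1} = 2 := by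
  apply le_antisymm
  · set f : ℝ × ℝ → E3 := fun q => (Real.cos q.2 * Real.cos q.1) • EuclideanSpace.single 0 (1 : ℝ)
      + (Real.cos q.2 * Real.sin q.1) • EuclideanSpace.single 1 (1 : ℝ)
      + Real.sin q.2 • EuclideanSpace.single 2 (1 : ℝ) with hf
    have hfd : ContDiff ℝ 1 f := by
      have := Real.contDiff_cos (n := 1)
      have := Real.contDiff_sin (n := 1)
      rw [hf]
      fun_prop
    have hsub : {d : E3 | ‖d‖ = 1} ⊆ Set.range f := by
      intro d hd
      have hn : d 0 ^ 2 + d 1 ^ 2 + d 2 ^ 2 = 1 := by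
        rw [← E3.norm_sq_eq, show ‖d‖ = 1 from hd, one_pow]
      have hz : d 2 ^ 2 ≤ 1 := by nlinarith [sq_nonneg (d 0), sq_nonneg (d 1)]
      obtain ⟨θ, h0, h1⟩ := exists_polar (x := d 0) (y := d 1) (r := √(1 - d 2 ^ 2))
        (Real.sqrt_nonneg _) (by rw [Real.sq_sqrt (by linarith)]; linarith)
      have hz' := abs_le.1 (abs_le_one_iff_mul_self_le_one.2 (by nlinarith : d 2 * d 2 ≤ 1))
      refine ⟨(θ, Real.arcsin (d 2)), ?_⟩
      have h2 := Real.sin_arcsin hz'.1 hz'.2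
      apply E3.ext <;> simp [hf, Real.cos_arcsin, h2, ← h0, ← h1]
    calc dimH {d : E3 | ‖d‖ = 1} ≤ dimH (Set.range f) := dimH_mono hsub
      _ ≤ Module.finrank ℝ (ℝ × ℝ) := hfd.dimH_range_le
      _ = 2 := by simp
  · set g : E3 →L[ℝ] ℝ × ℝ := (EuclideanSpace.proj 0).prod (EuclideanSpace.proj 1) with hg
    have hsub : {q : ℝ × ℝ | q.1 ^ 2 + q.2 ^ 2 < 1} ⊆ g '' {d : E3 | ‖d‖ = 1} := by
      rintro ⟨x, y⟩ hq
      have hq' : x ^ 2 + y ^ 2 < 1 := hq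
      refine ⟨!₂[x, y, √(1 - x ^ 2 - y ^ 2)], ?_, by simp [hg]⟩
      change ‖_‖ = 1
      rw [← sq_eq_sq₀ (norm_nonneg _) zero_le_one, E3.norm_sq_eq]
      simp [Real.sq_sqrt (show 0 ≤ 1 - x ^ 2 - y ^ 2 by linarith)]
    have hopen : IsOpen {q : ℝ × ℝ | q.1 ^ 2 + q.2 ^ 2 < 1} :=
      isOpen_lt (by fun_prop) continuous_const
    calc (2 : ENNReal) = dimH {q : ℝ × ℝ | q.1 ^ 2 + q.2 ^ 2 < 1} := by
          rw [Real.dimH_of_nonempty_interior (by rw [hopen.interior_eq]; exact ⟨(0, 0), by simp⟩)]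
          simp
      _ ≤ dimH (g '' {d : E3 | ‖d‖ = 1}) := dimH_mono hsub
      _ ≤ dimH {d : E3 | ‖d‖ = 1} := g.lipschitz.dimH_image_le _

lemma dimH_graph_pencilMap (a p k : ℝ) (M V A B : E3) (Z : Set E3) :
    dimH ((fun d => (M - pencilMap a p k V A B d, d)) '' Z) = dimH Z := by
  apply le_antisymm
  · have hd : ContDiff ℝ 1 fun d : E3 => (M - pencilMap a p k V A B d, d) := by
      unfold pencilMap
      have : ∀ W : E3, ContDiff ℝ 1 fun d : E3 => inner ℝ W d := fun W =>
        contDiff_const.inner ℝ contDiff_id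
      have hA := this A
      have hB := this B
      have hV := this V
      fun_prop
    exact hd.contDiffOn.dimH_image_le convex_univ (Set.subset_univ _)
  · have := LipschitzWith.prod_snd.dimH_image_le
      ((fun d => (M - pencilMap a p k V A B d, d)) '' Z)
    rwa [Set.image_image, Set.image_id'] at this

/-! ### The dimension of the set of placements -/

theorem theorem1 (L : LinearPentapod) (a₄ a_r a_c : ℝ) (M₅ : E3)
    (hL : L.IsType1 a₄ a_r a_c M₅ ∨ L.IsType2 a₄ a_r a_c M₅)
    (I : Set ℝ) (e f : ℝ → Fin 4 → ℝ) (hself : L.IsSelfMotion I e f) :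
    ∃ p₅ : ℝ,
      (∀ s ∈ I, inner ℝ (studyMap (e s) (f s) (L.point p₅) - M₅) (L.dirImage (e s) (f s)) = 0) ∧
      (¬ (p₅ = a₄ ∧ a₄ = a_r) → dimH (L.lineSymmetricPlacements I e f) = 1) ∧
      (p₅ = a₄ ∧ a₄ = a_r → dimH (L.lineSymmetricPlacements I e f) = 2) := by
  obtain ⟨V, A, B, ε, c, h⟩ : ∃ V A B ε c, L.HasNormalForm a₄ a_r a_c M₅ V A B ε c :=
    hL.elim (fun h => h.hasNormalForm) (fun h => h.hasNormalForm)
  set x : ℝ → E3 := fun s => studyMap (e s) (f s) (L.point 0) - M₅ with hx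
  set u : ℝ → E3 := fun s => L.dirImage (e s) (f s) with hu
  have hI : IsPreconnected I := hself.ordConnected.isPreconnected
  have huc : ContinuousOn u I := hself.continuousOn_dirImage
  have hn : ∀ s ∈ I, ‖u s‖ = 1 := fun s hs => L.norm_dirImage (hself.study s hs)
  have hpt : ∀ s t, studyMap (e s) (f s) (L.point t) = M₅ + x s + t • u s := fun s t => by
    rw [L.studyMap_point]; simp [hx, hu]
  obtain ⟨C, p₅, k, hconst⟩ := h.exists_constants hn (x := x) fun s hs i => by
    rw [← hself.legs s hs i, dist_eq_norm, hpt]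
  have hmove : ∃ s ∈ I, ∃ r ∈ I, u s ≠ u r := by
    obtain ⟨t, s, hs, r, hr, hne⟩ := hself.moves
    refine ⟨s, hs, r, hr, fun h0 => hne ?_⟩
    rw [hpt, hpt, (hconst s hs).1, (hconst r hr).1, h0]
  set p := (a₄ - a_r) / ‖V‖ ^ 2 with hp
  set κ := 1 / ‖B‖ ^ 2 with hκ
  have hplane : ∀ {m : E3} {q : ℝ}, (∀ s ∈ I, inner ℝ m (u s) = q) → m = 0 := fun hm =>
    h.not_planar hI huc hn hmove hconst hm
  -- the opposite direction of `p` belongs to the quadric of admissible directions `d`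
  have hquad : ∀ s ∈ I, p * inner ℝ V (u s) ^ 2 - inner ℝ C (u s) = p₅ - a_r := fun s hs =>
    direction_quadric (hconst s hs).1 (hn s hs) (hconst s hs).2.1
  set Z : Set E3 := {d | ‖d‖ = 1 ∧ p * inner ℝ V d ^ 2 + inner ℝ C d = p₅ - a_r} with hZ
  have hset : L.lineSymmetricPlacements I e f
      = (fun d => (M₅ - pencilMap a_r p (-κ) V A B d, d)) '' Z := by
    ext ⟨b, d⟩
    rw [L.mem_lineSymmetricPlacements_iff hself hmove]
    have hcond : ∀ s ∈ I, inner ℝ (studyMap (e s) (f s) (L.point 0) - b) (u s + d)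
        = (p * inner ℝ V d ^ 2 + a_r * ‖d‖ ^ 2 + inner ℝ C d - p₅)
          - inner ℝ (pencilMap a_r p (-κ) V A B d + b - M₅) (u s + d) := by
      intro s hs
      obtain ⟨e1, e2, -⟩ := hconst s hs
      have e3 : inner ℝ (x s) d = inner ℝ C d - inner ℝ (pencilMap a_r p (-κ) V A B d) (u s) := by
        rw [e1, inner_sub_left, ← inner_pencilMap, real_inner_comm d
            (pencilMap a_r p κ V A B (u s))]
      have e4 := inner_self_pencilMap a_r p (-κ) V A B d
      rw [real_inner_comm] at e4
      rw [hpt]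
      simp only [inner_add_left, inner_sub_left, inner_add_right, zero_smul, add_zero, e2, e3, e4]
      ring
    constructor
    · rintro ⟨hd, hor⟩
      have h0 : pencilMap a_r p (-κ) V A B d + b - M₅ = 0 :=
        hplane (q := p * inner ℝ V d ^ 2 + a_r * ‖d‖ ^ 2 + inner ℝ C d - p₅
          - inner ℝ (pencilMap a_r p (-κ) V A B d + b - M₅) d) fun s hs => by
            have h1 := hor s hs
            rw [hcond s hs, inner_add_right] at h1
            linear_combination -h1
      obtain ⟨s, hs, -⟩ := hmove
      have h1 := hor s hs
      rw [hcond s hs, h0, inner_zero_left, hd] at h1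
      refine ⟨d, ⟨hd, by linear_combination h1⟩, ?_⟩
      refine Prod.ext ?_ rfl
      change M₅ - pencilMap a_r p (-κ) V A B d = b
      rw [← sub_eq_zero, ← neg_eq_zero, ← h0]
      abel
    · rintro ⟨d', ⟨hd, hdq⟩, heq⟩
      obtain ⟨rfl, rfl⟩ := Prod.mk.inj heq
      refine ⟨hd, fun s hs => ?_⟩
      rw [hcond s hs, add_sub_cancel, sub_self, inner_zero_left, hd]
      linear_combination hdq
  rw [hset, dimH_graph_pencilMap]
  have hlow : 1 ≤ dimH Z := by
    refine one_le_dimH hI huc.neg ?_ (fun s hs => ?_)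
    · obtain ⟨s, hs, r, hr, hne⟩ := hmove
      exact ⟨s, hs, r, hr, fun h0 => hne (neg_injective h0)⟩
    · change ‖-u s‖ = 1 ∧ p * inner ℝ V (-u s) ^ 2 + inner ℝ C (-u s) = p₅ - a_r
      refine ⟨by rw [norm_neg, hn s hs], ?_⟩
      rw [inner_neg_right, inner_neg_right, ← hquad s hs]
      ring
  -- if `a₄ = a_r`, the quadric is a plane, which contains no self-motion unless it degenerates
  have hspecial : a₄ = a_r → C = 0 ∧ p₅ = a₄ := by
    intro ha
    have hp0 : p = 0 := by rw [hp, ha, sub_self, zero_div]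
    have hC : C = 0 := hplane (q := a_r - p₅) fun s hs => by
      have := hquad s hs
      rw [hp0] at this
      linear_combination -this
    obtain ⟨s, hs, -⟩ := hmove
    have := hquad s hs
    rw [hp0, hC, inner_zero_left] at this
    exact ⟨hC, by linear_combination -this - ha⟩
  refine ⟨p₅, fun s hs => ?_, fun hne => le_antisymm ?_ hlow, fun ⟨h1, h2⟩ => ?_⟩
  · have h1 := (hconst s hs).2.1
    rw [hpt, show M₅ + x s + p₅ • u s - M₅ = x s + p₅ • u s by abel]
    change inner ℝ (x s + p₅ • u s) (u s) = 0
    rw [inner_add_left, h1, real_inner_smul_left, real_inner_self_eq_norm_sq, hn s hs]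
    ring
  · refine dimH_sphere_inter_cylinder_le ?_ h.V_ne
    have hV2 : ‖V‖ ≠ 0 := by simpa using h.V_ne
    have ha : a₄ ≠ a_r := fun ha => hne ⟨(hspecial ha).2, ha⟩
    exact div_ne_zero (sub_ne_zero.2 ha) (by positivity)
  · obtain ⟨hC, -⟩ := hspecial h2
    have : Z = {d : E3 | ‖d‖ = 1} := by
      ext d
      simp [hZ, hC, hp, h1, h2]
    rw [this, dimH_unitSphere]
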